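/- **Setting.** Let $G=(V,E)$ be a finite undirected graph (parallel edges allowed, no loops), and let $\mathcal S=\{S_1,\dots,S_s\}$ be a family of pairwise disjoint vertex subsets (some may be empty) whose union $\Sigma$ has $2k$ elements, called terminals. Enumerate $\Sigma$ as $u_1,\dots,u_{2k}$ so that the parts are listed one after the other: if $i\le j$, $u_i\in S_\alpha$ and $u_j\in S_\beta$, then $\alpha\le\beta$. Assume that no edge joins two terminals, and put $\tilde V=V\setminus\Sigma$. Let $F_{2k}$ be the set of permutations $\sigma$ of $\{1,\dots,2k\}$ with $\sigma(1)<\sigma(3)<\dots<\sigma(2k-1)$ and $\sigma(2i-1)<\sigma(2i)$ for all $i$. A *disjoint $\mathcal S$-path* is an edge set $P$ that is the union of $k$ pairwise vertex-disjoint (simple) paths $P_1,\dots,P_k$ such that, for some $\sigma\in F_{2k}$, each $P_i$ connects $u_{\sigma(2i-1)}$ and $u_{\sigma(2i)}$, and these two terminals lie in distinct parts. Such a $\sigma=\sigma_P$ is unique; put $\operatorname{sgn}P=\operatorname{sgn}\sigma_P$. Say that $\mathcal S$ is in the *LGV position* if $\operatorname{sgn}P$ is the same for all disjoint $\mathcal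 S$-paths $P$. Let $b_1,\dots,b_s$ be pairwise linearly independent row vectors of length two over a field $\mathbb K$, and put $c_P=\prod_{i=1}^k\det\begin{pmatrix}b_{\alpha_{2i-1}}\\ b_{\alpha_{2i}}\end{pmatrix}\neq0$, where $u_{\sigma_P(j)}\in S_{\alpha_j}$. Let $G^*$ be $G$ with a new vertex $v^*$ and the new edges $E'=\{\{v,v^*\}: v\in\tilde V\}$; put $E^*=E\cup E'$ and fix any orientation of $G^*$. Let $A$ be the matrix over $\mathbb K$ with one row for each of $u_1,\dots,u_{2k}$ (in this order), followed by two consecutive rows for each $v\in\tilde V$, and with two consecutive columns (a *line*) for each $e\in E^*$. Its blocks are as follows. The $1\times2$ block of $u_i\in S_\alpha$ and $e$ is $b_\alpha$ if $u_i\in e$, and $0$ otherwise. The $2\times2$ block of $v\in\tilde V$ and $e$ is, if $e$ contains a terminal, $I_2$ when $v\in e$ and $0$ otherwise; and, if $e$ contains no terminal, $+I_2$, $-I_2$ or $0$ according to whether $v$ is the tail of $e$, the head of $e$, or neither. A *parity base* of $(A,E^*)$ is a set $B\subseteq E^*$ of lines whose columns form a nonsingular square matrix $A[B]$. The matroid parity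 $(A,E^*)$ is *Pfaffian with constant $c\ne0$* if $\det A[B]=c$ for all parity bases $B$. Given $l\colon E\to\mathbb R_{>0}$, let $w=l$ on $E$ and $w=0$ on $E'$; lengths and weights of sets are sums. **Theorem.** 1. If $P$ is a disjoint $\mathcal S$-path and $B$ is a parity base of $(A,E^*)$ containing $P$, then $\det A[B]=(-1)^k\,c_P\operatorname{sgn}P$. 2. If $s=3$, i.e. $\mathcal S=\{S,T,U\}$, then $c_P$ is the same for all disjoint $S$–$T$–$U$ paths $P$. If moreover $\{S,T,U\}$ is in the LGV position, then $(A,E^*)$ is Pfaffian, with constant $(-1)^k c_P\operatorname{sgn}P$ for an arbitrary disjoint $S$–$T$–$U$ path $P$. 3. For every $s$, the minimum length of a disjoint $\mathcal S$-path equals the minimum weight of a parity base of $(A,E^*)$ (and one of the two minima exists if and only if the other does), and $B\mapsto B\cap E$ is a one-to-one correspondence from the minimum-weight parity bases of $(A,E^*)$ onto the shortest disjoint $\mathcal S$-paths of $G$. In particular this holds for shortest disjoint $S$–$T$–$U$ paths. -/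

import Mathlib

open scoped BigOperators

/-! ### Linear matroid parity

The ground set of the matroid is `L × Fin 2`, the line `l : L` being the pair of columns
`(l, 0), (l, 1)` in this order.  The rows are indexed by `ρ × Fin 2`, so there are `2 * card ρ` of
them, and the rows `(x, 0), (x, 1)` are consecutive, in this order.  The order in which the lines,
or the pairs of rows, are listed does not influence any determinant `det A[J]`. -/

namespace MatroidParity

variable {ρ L K : Type*} [Fintype ρ] [DecidableEq ρ] [Field K]

/-- The square matrix `A[J]`: the columns of the lines in `J`, listed through `e`. -/
def lineSubmatrix (A : Matrix (ρ × Fin 2) (L × Fin 2) K) {J : Finset L} (e : ρ ≃ J) :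
    Matrix (ρ × Fin 2) (ρ × Fin 2) K :=
  A.submatrix id (fun x => ((e x.1 : L), x.2))

open Classical in
/-- `det A[J]` for a set `J` of lines such that `A[J]` is square (and `0` if it is not square). -/
noncomputable def detLines (A : Matrix (ρ × Fin 2) (L × Fin 2) K) (J : Finset L) : K :=
  if h : Nonempty (ρ ≃ J) then (lineSubmatrix A (Classical.choice h)).det else 0

/-- `det A[J]` does not depend on the listing of the lines. -/
theorem det_lineSubmatrix_eq (A : Matrix (ρ × Fin 2) (L × Fin 2) K) {J : Finset L}
    (e e' : ρ ≃ J) : (lineSubmatrix A e).det = (lineSubmatrix A e').det := by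
  have h : lineSubmatrix A e =
      (lineSubmatrix A e').submatrix id
        (Equiv.prodCongrLeft (fun _ : Fin 2 => e.trans e'.symm)) := by
    ext x y
    simp [lineSubmatrix]
  rw [h, Matrix.det_permute', Equiv.Perm.sign_prodCongrLeft]
  simp

theorem detLines_eq (A : Matrix (ρ × Fin 2) (L × Fin 2) K) {J : Finset L} (e : ρ ≃ J) :
    detLines A J = (lineSubmatrix A e).det := by
  rw [detLines, dif_pos ⟨e⟩]
  exact det_lineSubmatrix_eq A _ e

/-- `J` is a parity base of `(A, L)`: `A[J]` is square and nonsingular. -/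
def IsParityBase (A : Matrix (ρ × Fin 2) (L × Fin 2) K) (J : Finset L) : Prop :=
  J.card = Fintype.card ρ ∧ detLines A J ≠ 0

/-- `(A, L)` is a Pfaffian parity with constant `c`. -/
def IsPfaffianWithConstant (A : Matrix (ρ × Fin 2) (L × Fin 2) K) (c : K) : Prop :=
  c ≠ 0 ∧ ∀ J : Finset L, IsParityBase A J → detLines A J = c

/-- `(A, L)` is a Pfaffian parity. -/
def IsPfaffian (A : Matrix (ρ × Fin 2) (L × Fin 2) K) : Prop :=
  ∃ c : K, IsPfaffianWithConstant A c

/-- `J` is a parity base of `(A, L)` of minimum weight with respect to `w`. -/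
def IsMinWeightParityBase (A : Matrix (ρ × Fin 2) (L × Fin 2) K) (w : L → ℝ)
    (J : Finset L) : Prop :=
  IsParityBase A J ∧ ∀ J' : Finset L, IsParityBase A J' → ∑ e ∈ J, w e ≤ ∑ e ∈ J', w e

end MatroidParity

/-! ### Disjoint paths between the parts of a family of terminals -/

namespace Mader

/-- The position `2 i - 1` (for `j = 0`) or `2 i` (for `j = 1`) of `1, …, 2 k`, in zero-based
numbering. -/
def slot {k : ℕ} (i : Fin k) (j : Fin 2) : Fin (2 * k) :=
  ⟨2 * i.val + j.val, by omega⟩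

/-- The set `F_{2k}` of permutations `σ` with `σ(1) < σ(3) < ⋯ < σ(2k-1)` and
`σ(2i-1) < σ(2i)` for all `i`. -/
def pairingPerms (k : ℕ) : Set (Equiv.Perm (Fin (2 * k))) :=
  {σ | (∀ i j : Fin k, i < j → σ (slot i 0) < σ (slot j 0)) ∧
    ∀ i : Fin k, σ (slot i 0) < σ (slot i 1)}

/-- A family `part` of pairwise disjoint vertex sets with `2 k` elements (the terminals) in total,
together with an enumeration `term` of the terminals that lists the parts one after the other;
`label i` is the index of the part that contains `term i`. -/
structure TerminalFamily (V : Type*) (s k : ℕ) where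
  part : Fin s → Finset V
  disjoint_part : ∀ a a' : Fin s, a ≠ a' → Disjoint (part a) (part a')
  term : Fin (2 * k) → V
  term_injective : Function.Injective term
  label : Fin (2 * k) → Fin s
  term_mem_part : ∀ i, term i ∈ part (label i)
  exists_term_eq : ∀ a, ∀ v ∈ part a, ∃ i, term i = v
  label_mono : Monotone label

/-- The vertices that are not terminals. -/
def TerminalFamily.Free {V : Type*} {s k : ℕ} (T : TerminalFamily V s k) : Type _ :=
  {v : V // ∀ i, T.term i ≠ v}

noncomputable instance {V : Type*} [Fintype V] {s k : ℕ} (T : TerminalFamily V s k) :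
    Fintype T.Free := by
  classical exact inferInstanceAs (Fintype {v : V // ∀ i, T.term i ≠ v})

instance {V : Type*} [DecidableEq V] {s k : ℕ} (T : TerminalFamily V s k) :
    DecidableEq T.Free :=
  inferInstanceAs (DecidableEq {v : V // ∀ i, T.term i ≠ v})

/-- `IsPath G x y F W`: `F` and `W` are the edge set and the vertex set of a path (without repeated
vertices) of `G` between `x` and `y`. -/
inductive IsPath {V E : Type*} (G : Graph V E) : V → V → Set E → Set V → Prop
  | nil (x : V) (hx : x ∈ G.vertexSet) : IsPath G x x ∅ {x}
  | cons {x y z : V} {e : E} {F : Set E} {W : Set V} (h : G.IsLink e x y)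
      (p : IsPath G y z F W) (hx : x ∉ W) : IsPath G x z (insert e F) (insert x W)

section Paths

variable {V E : Type*} {s k : ℕ} (G : Graph V E) (T : TerminalFamily V s k)

/-- `P` is the union of `k` pairwise vertex-disjoint paths `P_1, …, P_k` such that `P_i` connects
the terminals number `σ(2i-1)` and `σ(2i)`, which lie in distinct parts, where `σ ∈ F_{2k}`. -/
def ConnectsVia (P : Finset E) (σ : Equiv.Perm (Fin (2 * k))) : Prop :=
  σ ∈ pairingPerms k ∧
  ∃ (F : Fin k → Set E) (W : Fin k → Set V),
    (∀ i, T.label (σ (slot i 0)) ≠ T.label (σ (slot i 1)) ∧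
      IsPath G (T.term (σ (slot i 0))) (T.term (σ (slot i 1))) (F i) (W i)) ∧
    (∀ i j, i ≠ j → Disjoint (W i) (W j)) ∧
    (P : Set E) = ⋃ i, F i

/-- `P` is a disjoint `𝒮`-path. -/
def IsDisjointPath (P : Finset E) : Prop :=
  ∃ σ, ConnectsVia G T P σ

open Classical in
/-- The permutation `σ_P` of a disjoint `𝒮`-path `P`. -/
noncomputable def pathPerm (P : Finset E) : Equiv.Perm (Fin (2 * k)) :=
  if h : IsDisjointPath G T P then Classical.choose h else 1

/-- The sign `sgn P = sgn σ_P`. -/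
noncomputable def pathSign (P : Finset E) : ℤ :=
  (Equiv.Perm.sign (pathPerm G T P) : ℤ)

/-- The number `c_P = ∏ i, det (b_{α(2i-1)} ; b_{α(2i)})`, where `α(j)` is the index of the part
that contains the terminal number `σ_P(j)`. -/
noncomputable def pathConst {K : Type*} [Field K] (b : Fin s → Fin 2 → K) (P : Finset E) : K :=
  ∏ i : Fin k, Matrix.det (Matrix.of
    ![b (T.label (pathPerm G T P (slot i 0))), b (T.label (pathPerm G T P (slot i 1)))])

/-- The family of terminals is in the LGV position. -/
def InLGVPosition : Prop :=
  ∀ P Q : Finset E, IsDisjointPath G T P → IsDisjointPath G T Q →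
    pathSign G T P = pathSign G T Q

/-- `P` is a disjoint `𝒮`-path of minimum length. -/
def IsShortestDisjointPath (l : E → ℝ) (P : Finset E) : Prop :=
  IsDisjointPath G T P ∧
    ∀ Q : Finset E, IsDisjointPath G T Q → ∑ e ∈ P, l e ≤ ∑ e ∈ Q, l e

end Paths

/-! ### The reduction to linear matroid parity -/

/-- An orientation of a graph all of whose potential edges `e : E` are edges. -/
structure Orientation {V E : Type*} (G : Graph V E) where
  tail : E → V
  head : E → V
  isLink : ∀ e, G.IsLink e (tail e) (head e)

/-- The incidence matrix of an orientation. -/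
def Orientation.inc {V E : Type*} [DecidableEq V] {G : Graph V E} (o : Orientation G)
    (K : Type*) [Field K] : Matrix V E K :=
  fun v e => if v = o.tail e then 1 else if v = o.head e then -1 else 0

open Classical in
/-- The matrix `X` of a graph with terminals (no two of which are adjacent).  The row `(inl i, j)`
is the row of the terminal in position `slot i j`, and `(inr v, 0)`, `(inr v, 1)` are the two rows
of the non-terminal `v`.  The line of the edge `e` is made up of the columns `(e, 0)`, `(e, 1)`. -/
noncomputable def schrijverMatrix {V E K : Type*} [DecidableEq V] [Field K] {s k : ℕ}
    (G : Graph V E) (T : TerminalFamily V s k) (o : Orientation G) (b : Fin s → Fin 2 → K) :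
    Matrix ((Fin k ⊕ T.Free) × Fin 2) (E × Fin 2) K :=
  fun r c => match r with
    | (Sum.inl i, j) =>
        if G.Inc c.1 (T.term (slot i j)) then b (T.label (slot i j)) c.2 else 0
    | (Sum.inr v, j) =>
        (if ∃ i, G.Inc c.1 (T.term i) then (if G.Inc c.1 v.1 then 1 else 0) else o.inc K v.1 c.1)
          * (1 : Matrix (Fin 2) (Fin 2) K) j c.2

/-- The graph `G*` (for a graph `G` with vertex set `V`): a new vertex `none` and a new edge
`inr v` between `v` and `none` for each non-terminal `v`. -/
def starGraph {V E : Type*} {s k : ℕ} (G : Graph V E) (T : TerminalFamily V s k) :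
    Graph (Option V) (E ⊕ T.Free) where
  vertexSet := Set.univ
  IsLink e x y := match e with
    | Sum.inl e => ∃ a a', G.IsLink e a a' ∧ x = some a ∧ y = some a'
    | Sum.inr v => (x = some v.1 ∧ y = none) ∨ (x = none ∧ y = some v.1)
  isLink_symm := by
    rintro (e | v) _
    · exact ⟨fun x y ⟨a, a', h, hx, hy⟩ => ⟨a', a, h.symm, hy, hx⟩⟩
    · exact ⟨fun x y h => h.elim (fun h => Or.inr ⟨h.2, h.1⟩) (fun h => Or.inl ⟨h.2, h.1⟩)⟩
  eq_or_eq_of_isLink_of_isLink := by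
    rintro (e | v) x y z w
    · rintro ⟨a, a', h, rfl, rfl⟩ ⟨c, c', h', rfl, rfl⟩
      simpa using G.eq_or_eq_of_isLink_of_isLink h h'
    · rintro (⟨rfl, rfl⟩ | ⟨rfl, rfl⟩) (⟨rfl, rfl⟩ | ⟨rfl, rfl⟩) <;> simp
  left_mem_of_isLink := by
    intros
    exact Set.mem_univ _

/-- The terminals of `G`, as terminals of `G*`. -/
def TerminalFamily.lift {V : Type*} {s k : ℕ} (T : TerminalFamily V s k) :
    TerminalFamily (Option V) s k where
  part a := (T.part a).map Function.Embedding.some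
  disjoint_part a a' h := by
    simpa [Finset.disjoint_map] using T.disjoint_part a a' h
  term i := some (T.term i)
  term_injective i j h := T.term_injective (Option.some_injective _ h)
  label := T.label
  term_mem_part i := by simpa using T.term_mem_part i
  exists_term_eq a v hv := by
    obtain ⟨x, hx, rfl⟩ := Finset.mem_map.1 hv
    obtain ⟨i, hi⟩ := T.exists_term_eq a x hx
    exact ⟨i, by simp [hi]⟩
  label_mono := T.label_mono

/-- A non-terminal of `G`, as a non-terminal of `G*`. -/
def TerminalFamily.Free.toLift {V : Type*} {s k : ℕ} {T : TerminalFamily V s k} (v : T.Free) :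
    T.lift.Free :=
  ⟨some v.1, fun i h => v.2 i (Option.some_injective _ h)⟩

/-- The matrix `A`: the matrix `X*` of `G*` without the two rows of the new vertex.  Its set of
lines is `E* = E ⊕ E'`, where the edges in `E'` are named by the non-terminals. -/
noncomputable def yamaguchiMatrix {V E K : Type*} [DecidableEq V] [Field K] {s k : ℕ}
    (G : Graph V E) (T : TerminalFamily V s k) (o : Orientation (starGraph G T))
    (b : Fin s → Fin 2 → K) :
    Matrix ((Fin k ⊕ T.Free) × Fin 2) ((E ⊕ T.Free) × Fin 2) K :=
  (schrijverMatrix (starGraph G T) T.lift o b).submatrix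
    (fun r => (Sum.map id TerminalFamily.Free.toLift r.1, r.2)) id

/-- The weight `w` on `E*`: the length on `E`, and zero on `E'`. -/
def starWeight {V E : Type*} {s k : ℕ} (T : TerminalFamily V s k) (l : E → ℝ) :
    E ⊕ T.Free → ℝ :=
  Sum.elim l (fun _ => 0)

end Mader

/-! Up to sign, every column of the underlying signed incidence matrix (`signedInc`) is `1_x - 1_y`
for an edge of `G` and a single unit vector for a new edge. So both kernels of `A[B]` have a graph
meaning. A left kernel vector is a potential with values in `K²` that is constant along the edges of
`B ∩ E`, zero at the non-terminals whose new edge is in `B`, and a multiple of `b_α` at a terminal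
of part `α` (`isParityBase_iff`). A right kernel vector is a `K²`-valued flow on `B`, conserved at
non-terminals, whose excess at each terminal is orthogonal to its `b_α` (`rightKernel_eq_zero`).

Counting unknowns for flows shows that a component of `B ∩ E` has at most two terminals, and no new
edge if it has one; a potential supported on one component shows that a terminal is joined to a
terminal of another part. Hence a parity base contains a disjoint path. Conversely, a disjoint path
extends by new edges to a parity base in exactly one way: take the new edges at the vertices off the
path (`isParityBase_iff_toRight_eq`). Since lengths are positive and new edges weigh nothing, the
two minimization problems agree.

For the determinant (`detLines_eq_of_connectsVia`), replace the column of one edge on each path by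
the unit flow along that path. This operation has the form `R ⊗ I₂` with `det R = ±1`, hence
determinant `1`. The result is block triangular: the terminal block gives `(-1)^k c_P sgn P`, and
the other diagonal block is `N ⊗ I₂` with `N` a square submatrix of a directed incidence matrix up
to column signs, so `(det N)² = 1` as soon as it is nonzero. With three parts, `c_P` depends only on
how many paths join each two parts, and these numbers follow from the sizes of the parts. -/

namespace Mader

open Matrix MatroidParity

/-- `slot` as an equivalence. -/
def slotEquiv (k : ℕ) : Fin k × Fin 2 ≃ Fin (2 * k) :=
  finProdFinEquiv.trans (finCongr (mul_comm k 2))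

theorem slotEquiv_apply {k : ℕ} (i : Fin k) (j : Fin 2) : slotEquiv k (i, j) = slot i j := by
  ext
  simp [slotEquiv, slot, finProdFinEquiv, add_comm]

theorem exists_slot_eq {k : ℕ} (a : Fin (2 * k)) : ∃ i j, slot i j = a := by
  obtain ⟨⟨i, j⟩, rfl⟩ := (slotEquiv k).surjective a
  exact ⟨i, j, (slotEquiv_apply i j).symm⟩

theorem slot_inj {k : ℕ} {i i' : Fin k} {j j' : Fin 2} (h : slot i j = slot i' j') :
    i = i' ∧ j = j' := by
  rw [← slotEquiv_apply, ← slotEquiv_apply, (slotEquiv k).injective.eq_iff] at h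
  simpa using h

/-! ### The signed incidence matrix behind the matrix `A` -/

section SignedIncidence

variable {V E K : Type*} [DecidableEq V] [Field K] {s k : ℕ} {G : Graph V E}

theorem TerminalFamily.free_or_eq_term (T : TerminalFamily V s k) (x : V) :
    (∃ i, T.term i = x) ∨ ∃ v : T.Free, v.1 = x := by
  by_cases h : ∃ i, T.term i = x
  · exact Or.inl h
  · exact Or.inr ⟨⟨x, fun i hi => h ⟨i, hi⟩⟩, rfl⟩

/-- A sum over all vertices, split into terminals and non-terminals. -/
theorem TerminalFamily.sum_eq [Fintype V] (T : TerminalFamily V s k) {M : Type*} [AddCommMonoid M]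
    (f : V → M) :
    ∑ x, f x = ∑ a, f (T.term a) + ∑ v : T.Free, f v.1 := by
  let g : Fin (2 * k) ⊕ T.Free → V := Sum.elim T.term (fun v => v.1)
  have hg : Function.Bijective g := by
    constructor
    · rintro (a | v) (a' | v') h
      · exact congrArg Sum.inl (T.term_injective h)
      · exact absurd h (v'.2 a)
      · exact absurd h.symm (v.2 a')
      · exact congrArg Sum.inr (Subtype.ext h)
    · intro x
      rcases T.free_or_eq_term x with ⟨i, hi⟩ | ⟨v, hv⟩
      · exact ⟨Sum.inl i, hi⟩
      · exact ⟨Sum.inr v, hv⟩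
  rw [← (Equiv.ofBijective g hg).sum_comp, Fintype.sum_sum_type]
  rfl

theorem sum_slot {k : ℕ} {M : Type*} [AddCommMonoid M] (f : Fin (2 * k) → M) :
    ∑ a, f a = ∑ i, ∑ j, f (slot i j) := by
  rw [← (slotEquiv k).sum_comp, Fintype.sum_prod_type]
  simp [slotEquiv_apply]

open Classical in
/-- The signed incidence matrix underlying `yamaguchiMatrix`; an edge at a terminal is directed
away from the terminal. -/
noncomputable def signedInc (T : TerminalFamily V s k) (o : Orientation (starGraph G T))
    (K : Type*) [Field K] (x : V) (e : E ⊕ T.Free) : K :=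
  if ∃ i, T.term i = x then (if (starGraph G T).Inc e (some x) then -1 else 0)
  else if ∃ i, (starGraph G T).Inc e (some (T.term i)) then
    (if (starGraph G T).Inc e (some x) then 1 else 0)
  else o.inc K (some x) e

variable (T : TerminalFamily V s k) (o : Orientation (starGraph G T)) (b : Fin s → Fin 2 → K)

-- The minus sign cancels the entry `-1` that `signedInc` has at a terminal. In return, every column
-- of an edge of `G` becomes `±(1_x - 1_y)`, whether or not the edge has a terminal end.
open Classical in
theorem yamaguchiMatrix_inl (i : Fin k) (j c : Fin 2) (e : E ⊕ T.Free) :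
    yamaguchiMatrix G T o b (Sum.inl i, j) (e, c) =
      - signedInc T o K (T.term (slot i j)) e * b (T.label (slot i j)) c := by
  have h : ∃ i', T.term i' = T.term (slot i j) := ⟨_, rfl⟩
  have h' : yamaguchiMatrix G T o b (Sum.inl i, j) (e, c) =
    if (starGraph G T).Inc e (some (T.term (slot i j))) then b (T.label (slot i j)) c else 0 := rfl
  rw [h', signedInc, if_pos h]
  split_ifs <;> simp

open Classical in
theorem yamaguchiMatrix_inr (v : T.Free) (j c : Fin 2) (e : E ⊕ T.Free) :
    yamaguchiMatrix G T o b (Sum.inr v, j) (e, c) =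
      signedInc T o K v.1 e * (1 : Matrix (Fin 2) (Fin 2) K) j c := by
  have h : ¬ ∃ i', T.term i' = v.1 := fun ⟨i, hi⟩ => v.2 i hi
  have h' : yamaguchiMatrix G T o b (Sum.inr v, j) (e, c) =
    (if ∃ i, (starGraph G T).Inc e (some (T.term i)) then
      (if (starGraph G T).Inc e (some v.1) then 1 else 0) else o.inc K (some v.1) e)
        * (1 : Matrix (Fin 2) (Fin 2) K) j c := rfl
  rw [h', signedInc, if_neg h]

omit [DecidableEq V] in
theorem starGraph_inc_inl {e : E} {x : V} :
    (starGraph G T).Inc (Sum.inl e) (some x) ↔ G.Inc e x := by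
  constructor
  · rintro ⟨_, a, a', h, hx, _⟩
    cases hx
    exact ⟨a', h⟩
  · rintro ⟨y, h⟩
    exact ⟨some y, x, y, h, rfl, rfl⟩

omit [DecidableEq V] in
theorem starGraph_inc_inr {v : T.Free} {x : V} :
    (starGraph G T).Inc (Sum.inr v) (some x) ↔ x = v.1 := by
  constructor
  · rintro ⟨_, ⟨h, _⟩ | ⟨h, _⟩⟩
    · exact Option.some_injective _ h
    · cases h
  · rintro rfl
    exact ⟨none, Or.inl ⟨rfl, rfl⟩⟩

/-- The column of an edge `e` of `G` has entries `1` and `-1` at the ends of `e`. -/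
theorem signedInc_inl (hloop : G.Loopless) (hT : ∀ e i j, ¬ G.IsLink e (T.term i) (T.term j))
    {e : E} {x y : V} (h : G.IsLink e x y) :
    ∃ ε : K, (ε = 1 ∨ ε = -1) ∧ ∀ z, signedInc T o K z (Sum.inl e) =
      ε * ((if z = x then 1 else 0) - (if z = y then 1 else 0)) := by
  have hxy : x ≠ y := h.ne
  have hinc : ∀ z, G.Inc e z ↔ z = x ∨ z = y := fun z =>
    ⟨fun hz => hz.eq_or_eq_of_isLink h, by
      rintro (rfl | rfl)
      exacts [h.inc_left, h.inc_right]⟩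
  -- A terminal end always has entry `-1`, which fixes `ε` in the first two cases. Without a
  -- terminal end, `ε` tells whether `o` directs the edge from `x` to `y`.
  by_cases hx : ∃ i, T.term i = x
  · have hy : ¬ ∃ i, T.term i = y := by
      rintro ⟨j, rfl⟩
      obtain ⟨i, rfl⟩ := hx
      exact hT _ _ _ h
    have he : ∃ i, x = T.term i ∨ y = T.term i := hx.imp fun i hi => Or.inl hi.symm
    refine ⟨-1, Or.inr rfl, fun z => ?_⟩
    simp only [signedInc, starGraph_inc_inl, hinc]
    by_cases hzx : z = x
    · subst hzx
      simp [hx, hxy]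
    · by_cases hzy : z = y
      · subst hzy
        rw [if_neg hy, if_pos (he.imp fun i => Or.imp Eq.symm Eq.symm)]
        simp [hzx]
      · rw [if_pos (he.imp fun i => Or.imp Eq.symm Eq.symm)]
        simp [hzx, hzy]
  by_cases hy : ∃ i, T.term i = y
  · have he : ∃ i, T.term i = x ∨ T.term i = y := hy.imp fun i hi => Or.inr hi
    refine ⟨1, Or.inl rfl, fun z => ?_⟩
    simp only [signedInc, starGraph_inc_inl, hinc]
    by_cases hzx : z = x
    · subst hzx
      rw [if_neg hx, if_pos he]
      simp [hxy]
    · by_cases hzy : z = y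
      · subst hzy
        simp [hy, hzx]
      · rw [if_pos he]
        simp [hzx, hzy]
  have he : ¬ ∃ i, T.term i = x ∨ T.term i = y := fun ⟨i, hi⟩ =>
    hi.elim (fun hi => hx ⟨i, hi⟩) (fun hi => hy ⟨i, hi⟩)
  have key : ∀ z, signedInc T o K z (Sum.inl e) = o.inc K (some z) (Sum.inl e) := by
    intro z
    simp only [signedInc, starGraph_inc_inl, hinc, if_neg he]
    split_ifs with h1 h2
    · rcases h2 with rfl | rfl
      exacts [absurd h1 hx, absurd h1 hy]
    · obtain ⟨a, a', h', ht, hh⟩ := o.isLink (Sum.inl e)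
      simp only [not_or] at h2
      rcases h'.eq_and_eq_or_eq_and_eq h with ⟨rfl, rfl⟩ | ⟨rfl, rfl⟩ <;>
        simp [Orientation.inc, ht, hh, h2]
    · rfl
  obtain ⟨a, a', h', ht, hh⟩ := o.isLink (Sum.inl e)
  rcases h'.eq_and_eq_or_eq_and_eq h with ⟨rfl, rfl⟩ | ⟨rfl, rfl⟩
  · refine ⟨1, Or.inl rfl, fun z => ?_⟩
    rw [key, Orientation.inc, ht, hh]
    by_cases hz : z = a
    · subst hz; simp [hxy]
    · simp only [Option.some_inj, hz, if_false]
      split_ifs <;> simp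
  · refine ⟨-1, Or.inr rfl, fun z => ?_⟩
    rw [key, Orientation.inc, ht, hh]
    by_cases hz : z = a
    · subst hz; simp [hxy.symm]
    · simp only [Option.some_inj, hz, if_false]
      split_ifs <;> simp

/-- The column of a new edge has a single nonzero entry. -/
theorem signedInc_inr (v : T.Free) :
    ∃ ε : K, (ε = 1 ∨ ε = -1) ∧ ∀ z, signedInc T o K z (Sum.inr v) = if z = v.1 then ε else 0 := by
  have he : ¬ ∃ i, T.term i = v.1 := fun ⟨i, hi⟩ => v.2 i hi
  have key : ∀ z, signedInc T o K z (Sum.inr v) = o.inc K (some z) (Sum.inr v) := by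
    intro z
    simp only [signedInc, starGraph_inc_inr, if_neg he]
    split_ifs with h1 h2
    · subst h2
      exact absurd h1 he
    · rcases o.isLink (Sum.inr v) with ⟨ht, hh⟩ | ⟨ht, hh⟩ <;>
        simp [Orientation.inc, ht, hh, h2]
    · rfl
  rcases o.isLink (Sum.inr v) with ⟨ht, hh⟩ | ⟨ht, hh⟩
  · refine ⟨1, Or.inl rfl, fun z => ?_⟩
    rw [key, Orientation.inc, ht, hh]
    simp
  · refine ⟨-1, Or.inr rfl, fun z => ?_⟩
    rw [key, Orientation.inc, ht, hh]
    simp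

end SignedIncidence

/-! ### Left and right kernels: potentials and flows -/

section Kernel

variable {V E K : Type*} [Fintype V] [DecidableEq V] [Field K] {s k : ℕ}
  {G : Graph V E} (T : TerminalFamily V s k) (o : Orientation (starGraph G T))
  (b : Fin s → Fin 2 → K)

theorem isParityBase_iff_det {B : Finset (E ⊕ T.Free)} (e : (Fin k ⊕ T.Free) ≃ B) :
    IsParityBase (yamaguchiMatrix G T o b) B ↔
      (lineSubmatrix (yamaguchiMatrix G T o b) e).det ≠ 0 := by
  rw [IsParityBase, detLines_eq _ e]
  refine and_iff_right ?_
  rw [Fintype.card_congr e, Fintype.card_coe]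

omit [DecidableEq V] in
theorem exists_listing {B : Finset (E ⊕ T.Free)} (h : B.card = Fintype.card (Fin k ⊕ T.Free)) :
    Nonempty ((Fin k ⊕ T.Free) ≃ B) :=
  Fintype.card_eq.1 (by rw [← h, Fintype.card_coe])

/-- Dictionary between row vectors and potentials: the two rows of a non-terminal allow an arbitrary
value in `K²`, while the single row of a terminal allows only multiples of its `b`. -/
theorem vecMul_yamaguchiMatrix (x : (Fin k ⊕ T.Free) × Fin 2 → K) (φ : V → Fin 2 → K)
    (hφ : ∀ i j c, φ (T.term (slot i j)) c = - x (Sum.inl i, j) * b (T.label (slot i j)) c)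
    (hφ' : ∀ v : T.Free, ∀ c, φ v.1 c = x (Sum.inr v, c)) (e : E ⊕ T.Free) (c : Fin 2) :
    ∑ r, x r * yamaguchiMatrix G T o b r (e, c) = ∑ z, φ z c * signedInc T o K z e := by
  rw [T.sum_eq, sum_slot, Fintype.sum_prod_type, Fintype.sum_sum_type]
  congr 1
  · refine Finset.sum_congr rfl fun i _ => Finset.sum_congr rfl fun j _ => ?_
    rw [yamaguchiMatrix_inl, hφ]
    ring
  · refine Finset.sum_congr rfl fun v _ => ?_
    simp only [yamaguchiMatrix_inr, hφ']
    simp [Matrix.one_apply]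

theorem sum_signedInc_inl (hloop : G.Loopless)
    (hT : ∀ e i j, ¬ G.IsLink e (T.term i) (T.term j)) {e : E} {x y : V} (h : G.IsLink e x y)
    (f : V → K) : ∑ z, f z * signedInc T o K z (Sum.inl e) = 0 ↔ f x = f y := by
  obtain ⟨ε, hε, hs⟩ := signedInc_inl (K := K) T o hloop hT h
  have : ∑ z, f z * signedInc T o K z (Sum.inl e) = ε * (f x - f y) := by
    simp only [hs, mul_sub, Finset.sum_sub_distrib]
    simp [mul_comm]
  rw [this]
  rcases hε with rfl | rfl <;> simp [sub_eq_zero, eq_comm]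

theorem sum_signedInc_inr (v : T.Free) (f : V → K) :
    ∑ z, f z * signedInc T o K z (Sum.inr v) = 0 ↔ f v.1 = 0 := by
  obtain ⟨ε, hε, hs⟩ := signedInc_inr (K := K) T o v
  have : ∑ z, f z * signedInc T o K z (Sum.inr v) = f v.1 * ε := by
    simp [hs]
  rw [this]
  rcases hε with rfl | rfl <;> simp

omit [DecidableEq V] in
theorem sum_lines [Fintype E] {B : Finset (E ⊕ T.Free)} (e : (Fin k ⊕ T.Free) ≃ B) (f : E ⊕ T.Free → K)
    (hf : ∀ a, a ∉ B → f a = 0) : ∑ r, f (e r) = ∑ a, f a := by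
  rw [e.sum_comp (fun a : B => f a), Finset.sum_coe_sort B f]
  exact Finset.sum_subset (Finset.subset_univ _) fun a _ ha => hf a ha

/-- Parity bases in terms of the left kernel: potentials on the vertices. -/
theorem isParityBase_iff (hE : G.edgeSet = Set.univ) (hloop : G.Loopless)
    (hT : ∀ e i j, ¬ G.IsLink e (T.term i) (T.term j)) (B : Finset (E ⊕ T.Free)) :
    IsParityBase (yamaguchiMatrix G T o b) B ↔
      B.card = Fintype.card (Fin k ⊕ T.Free) ∧
      ∀ (φ : V → Fin 2 → K) (y : Fin (2 * k) → K),
        (∀ a, φ (T.term a) = y a • b (T.label a)) →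
        (∀ e x z, Sum.inl e ∈ B → G.IsLink e x z → φ x = φ z) →
        (∀ v : T.Free, Sum.inr v ∈ B → φ v.1 = 0) →
        y = 0 ∧ ∀ v : T.Free, φ v.1 = 0 := by
  by_cases hcard : B.card = Fintype.card (Fin k ⊕ T.Free)
  swap
  · exact iff_of_false (fun h => hcard h.1) (fun h => hcard h.1)
  obtain ⟨e⟩ := exists_listing T hcard
  rw [isParityBase_iff_det T o b e, ← not_iff_not, not_not, ← exists_vecMul_eq_zero_iff]
  have hcol : ∀ (φ : V → Fin 2 → K), (∀ a ∈ B, ∀ c, ∑ z, φ z c * signedInc T o K z a = 0) ↔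
      (∀ e x z, Sum.inl e ∈ B → G.IsLink e x z → φ x = φ z) ∧
        (∀ v : T.Free, Sum.inr v ∈ B → φ v.1 = 0) := by
    intro φ
    constructor
    · refine fun h => ⟨fun a x z ha hl => funext fun c => ?_, fun v hv => funext fun c => ?_⟩
      · exact (sum_signedInc_inl T o hloop hT hl (fun z => φ z c)).1 (h _ ha c)
      · exact (sum_signedInc_inr T o v (fun z => φ z c)).1 (h _ hv c)
    · rintro ⟨h1, h2⟩ (a | v) ha c
      · obtain ⟨x, z, hl⟩ := G.exists_isLink_of_mem_edgeSet (e := a) (by rw [hE]; trivial)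
        exact (sum_signedInc_inl T o hloop hT hl (fun z => φ z c)).2
          (congrFun (h1 _ _ _ ha hl) c)
      · exact (sum_signedInc_inr T o v (fun z => φ z c)).2 (congrFun (h2 _ ha) c)
  have hvec : ∀ (x : (Fin k ⊕ T.Free) × Fin 2 → K) (φ : V → Fin 2 → K),
      (∀ i j c, φ (T.term (slot i j)) c = - x (Sum.inl i, j) * b (T.label (slot i j)) c) →
      (∀ v : T.Free, ∀ c, φ v.1 c = x (Sum.inr v, c)) →
      (x ᵥ* lineSubmatrix (yamaguchiMatrix G T o b) e = 0 ↔
        (∀ e x z, Sum.inl e ∈ B → G.IsLink e x z → φ x = φ z) ∧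
        (∀ v : T.Free, Sum.inr v ∈ B → φ v.1 = 0)) := by
    intro x φ h1 h2
    rw [← hcol φ, funext_iff]
    have : ∀ r c, (x ᵥ* lineSubmatrix (yamaguchiMatrix G T o b) e) (r, c) =
        ∑ z, φ z c * signedInc T o K z (e r) := fun r c =>
      vecMul_yamaguchiMatrix T o b x φ h1 h2 (e r) c
    constructor
    · intro h a ha c
      have h3 := h (e.symm ⟨a, ha⟩, c)
      rw [this] at h3
      simpa using h3
    · rintro h ⟨r, c⟩
      rw [this]
      exact h _ (e r).2 c
  simp only [hcard, true_and, not_forall]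
  constructor
  · rintro ⟨x, hx0, hx⟩
    choose si sj hs using (exists_slot_eq (k := k))
    have hsi : ∀ i j, si (slot i j) = i := fun i j => (slot_inj (hs (slot i j))).1
    have hsj : ∀ i j, sj (slot i j) = j := fun i j => (slot_inj (hs (slot i j))).2
    let y : Fin (2 * k) → K := fun a => - x (Sum.inl (si a), sj a)
    classical
    let φ : V → Fin 2 → K := fun z => if h : ∃ a, T.term a = z then
      y h.choose • b (T.label h.choose) else
        fun c => x (Sum.inr ⟨z, fun i hi => h ⟨i, hi⟩⟩, c)
    have hφ : ∀ a, φ (T.term a) = y a • b (T.label a) := by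
      intro a
      have h : ∃ a', T.term a' = T.term a := ⟨a, rfl⟩
      have h' : h.choose = a := T.term_injective h.choose_spec
      simp only [φ, dif_pos h]
      rw [h']
    have hφ' : ∀ (v : T.Free) c, φ v.1 c = x (Sum.inr v, c) := by
      intro v c
      have h : ¬ ∃ a', T.term a' = v.1 := fun ⟨a, ha⟩ => v.2 a ha
      simp only [φ, dif_neg h]
      rfl
    have := (hvec x φ (fun i j c => by rw [hφ]; simp [y, hsi, hsj]) hφ').1 hx
    refine ⟨φ, y, hφ, this.1, this.2, fun ⟨hy, hv⟩ => hx0 ?_⟩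
    funext r
    obtain ⟨i | v, c⟩ := r
    · have := congrFun hy (slot i c)
      simpa [y, hsi, hsj] using this
    · rw [← hφ', hv]
      rfl
  · rintro ⟨φ, y, h1, h2, h3, h4⟩
    let x : (Fin k ⊕ T.Free) × Fin 2 → K := fun r =>
      Sum.elim (fun i => - y (slot i r.2)) (fun v => φ v.1 r.2) r.1
    refine ⟨x, fun hx => h4 ⟨?_, ?_⟩, (hvec x φ ?_ ?_).2 ⟨h2, h3⟩⟩
    · funext a
      obtain ⟨i, j, rfl⟩ := exists_slot_eq a
      simpa [x] using congrFun hx (Sum.inl i, j)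
    · intro v
      funext c
      simpa [x] using congrFun hx (Sum.inr v, c)
    · intro i j c
      simp [h1, x]
    · intro v c
      rfl

/-- A parity base has no nonzero right kernel. -/
theorem rightKernel_eq_zero [Fintype E] {B : Finset (E ⊕ T.Free)}
    (hB : IsParityBase (yamaguchiMatrix G T o b) B) (Z : E ⊕ T.Free → Fin 2 → K)
    (hZ : ∀ a, a ∉ B → Z a = 0)
    (hv : ∀ (v : T.Free) c, ∑ a, signedInc T o K v.1 a * Z a c = 0)
    (ht : ∀ i, ∑ c, b (T.label i) c * ∑ a, signedInc T o K (T.term i) a * Z a c = 0) :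
    Z = 0 := by
  obtain ⟨e⟩ := exists_listing T hB.1
  rw [isParityBase_iff_det T o b e] at hB
  -- The coefficients of `Z` on `B` form a column vector for `A[B]`. The rows of non-terminals
  -- express conservation, and those of terminals the orthogonality `ht` up to sign.
  have key : (fun r : (Fin k ⊕ T.Free) × Fin 2 => Z (e r.1) r.2) = 0 := by
    by_contra hne
    refine hB (exists_mulVec_eq_zero_iff.1 ⟨_, hne, ?_⟩)
    funext r
    obtain ⟨i | v, j⟩ := r
    · simp only [mulVec, dotProduct, lineSubmatrix, submatrix_apply, id, Fintype.sum_prod_type,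
        yamaguchiMatrix_inl, Pi.zero_apply]
      rw [Finset.sum_comm, ← neg_eq_zero, ← ht (slot i j), ← Finset.sum_neg_distrib]
      refine Finset.sum_congr rfl fun c _ => ?_
      rw [← sum_lines T e _ (fun a ha => by simp [hZ a ha]), Finset.mul_sum,
        ← Finset.sum_neg_distrib]
      refine Finset.sum_congr rfl fun r _ => ?_
      ring
    · simp only [mulVec, dotProduct, lineSubmatrix, submatrix_apply, id, Fintype.sum_prod_type,
        yamaguchiMatrix_inr, Pi.zero_apply]
      rw [← hv v j, ← sum_lines T e _ (fun a ha => by simp [hZ a ha])]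
      refine Finset.sum_congr rfl fun r _ => ?_
      simp [Matrix.one_apply]
  funext a c
  by_cases ha : a ∈ B
  · simpa using congrFun key (e.symm ⟨a, ha⟩, c)
  · rw [hZ a ha]
    rfl

end Kernel

end Mader

namespace Mader

/-! ### Paths, connectivity and unit flows -/

section IsPath

variable {V E : Type*} {G : Graph V E} {x y : V} {F : Set E} {W : Set V}

theorem IsPath.left_mem (p : IsPath G x y F W) : x ∈ W := by
  cases p <;> simp

theorem IsPath.right_mem (p : IsPath G x y F W) : y ∈ W := by
  induction p with
  | nil => rfl
  | cons h p hx ih => exact Or.inr ih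

theorem IsPath.mem_of_isLink (p : IsPath G x y F W) {e : E} (he : e ∈ F) {a c : V}
    (h : G.IsLink e a c) : a ∈ W := by
  induction p with
  | nil => exact he.elim
  | cons h' p hx ih =>
    rcases he with rfl | he
    · rcases h.left_eq_or_eq h' with rfl | rfl
      exacts [Or.inl rfl, Or.inr p.left_mem]
    · exact Or.inr (ih he)

theorem IsPath.nonempty (p : IsPath G x y F W) (hxy : x ≠ y) : F.Nonempty := by
  cases p with
  | nil => exact absurd rfl hxy
  | cons => exact Set.insert_nonempty _ _

theorem IsPath.eq_of_mem {α : Type*} (p : IsPath G x y F W) (φ : V → α)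
    (hφ : ∀ e ∈ F, ∀ a c, G.IsLink e a c → φ a = φ c) {w : V} (hw : w ∈ W) : φ w = φ x := by
  induction p with
  | nil => rw [hw]
  | cons h p hx ih =>
    rcases hw with rfl | hw
    · rfl
    · rw [ih (fun e he => hφ e (Or.inr he)) hw]
      exact (hφ _ (Or.inl rfl) _ _ h).symm

theorem IsPath.finite (p : IsPath G x y F W) : W.Finite := by
  induction p with
  | nil => exact Set.finite_singleton _
  | cons h p hx ih => exact ih.insert _

theorem IsPath.ncard (p : IsPath G x y F W) : F.Finite ∧ F.ncard + 1 = W.ncard := by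
  induction p with
  | nil => simp
  | cons h p hx ih =>
    refine ⟨ih.1.insert _, ?_⟩
    rw [Set.ncard_insert_of_notMem (fun he => hx (p.mem_of_isLink he h)) ih.1,
      Set.ncard_insert_of_notMem hx p.finite, ih.2]

theorem IsPath.exists_suffix (p : IsPath G x y F W) {w : V} (hw : w ∈ W) :
    ∃ F' W', F' ⊆ F ∧ W' ⊆ W ∧ IsPath G w y F' W' := by
  induction p with
  | nil x hx =>
    obtain rfl : w = x := hw
    exact ⟨_, _, subset_rfl, subset_rfl, .nil _ hx⟩
  | cons h p hx ih =>
    rcases hw with rfl | hw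
    · exact ⟨_, _, subset_rfl, subset_rfl, .cons h p hx⟩
    · obtain ⟨F', W', hF, hW, p'⟩ := ih hw
      exact ⟨F', W', hF.trans (Set.subset_insert _ _), hW.trans (Set.subset_insert _ _), p'⟩

/-- Two vertices are joined by a sequence of edges in `Q`. -/
def Joined (G : Graph V E) (Q : Set E) : V → V → Prop :=
  Relation.ReflTransGen fun a c => ∃ e ∈ Q, G.IsLink e a c

theorem Joined.symm {Q : Set E} (h : Joined G Q x y) : Joined G Q y x := by
  induction h with
  | refl => exact .refl
  | tail _ hl ih =>
    obtain ⟨e, he, hl⟩ := hl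
    exact .head ⟨e, he, hl.symm⟩ ih

/-- A walk is shortened from its far end: when the next vertex already lies on the path built so
far, the loop is cut off by passing to a suffix. -/
theorem Joined.exists_isPath {Q : Set E} (hV : G.vertexSet = Set.univ) (h : Joined G Q x y) :
    ∃ F W, F ⊆ Q ∧ IsPath G x y F W := by
  induction h using Relation.ReflTransGen.head_induction_on with
  | refl => exact ⟨∅, {y}, Set.empty_subset _, .nil y (by rw [hV]; trivial)⟩
  | head hl _ ih =>
    obtain ⟨e, he, hl⟩ := hl
    obtain ⟨F, W, hF, p⟩ := ih
    rename_i a c _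
    by_cases ha : a ∈ W
    · obtain ⟨F', W', hF', _, p'⟩ := p.exists_suffix ha
      exact ⟨F', W', hF'.trans hF, p'⟩
    · exact ⟨_, _, Set.insert_subset he hF, .cons hl p ha⟩

theorem IsPath.joined {Q : Set E} (p : IsPath G x y F W) (hF : F ⊆ Q) {w : V} (hw : w ∈ W) :
    Joined G Q x w := by
  induction p with
  | nil =>
    obtain rfl : w = _ := hw
    exact .refl
  | cons h p hx ih =>
    rcases hw with rfl | hw
    · exact .refl
    · exact .head ⟨_, hF (Or.inl rfl), h⟩ (ih (fun e he => hF (Or.inr he)) hw)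

/-- The unit flow along a path. -/
theorem IsPath.exists_flow [Fintype E] [DecidableEq V] {K : Type*} [Field K]
    {s k : ℕ} (T : TerminalFamily V s k) (o : Orientation (starGraph G T))
    (hloop : G.Loopless) (hT : ∀ e i j, ¬ G.IsLink e (T.term i) (T.term j))
    (p : IsPath G x y F W) :
    ∃ Z : E → K, (∀ e, e ∉ F → Z e = 0) ∧ (∀ e ∈ F, Z e = 1 ∨ Z e = -1) ∧
      ∀ v, ∑ e, signedInc T o K v (Sum.inl e) * Z e =
        (if v = x then 1 else 0) - (if v = y then 1 else 0) := by
  classical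
  induction p with
  | nil => exact ⟨0, by simp, by simp, by simp⟩
  | @cons x c y e F W h p hx ih =>
    obtain ⟨Z, h0, h1, h2⟩ := ih
    obtain ⟨ε, hε, hs⟩ := signedInc_inl (K := K) T o hloop hT h
    have heF : e ∉ F := fun he => hx (p.mem_of_isLink he h)
    have hεε : ε * ε = 1 := by rcases hε with rfl | rfl <;> simp
    -- Since `ε * ε = 1`, the new edge contributes exactly `1_x - 1_c`, and the sum telescopes.
    refine ⟨Z + Pi.single e ε, fun e' he' => ?_, fun e' he' => ?_, fun v => ?_⟩
    · rw [Set.mem_insert_iff, not_or] at he'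
      simp [h0 _ he'.2, he'.1]
    · rcases he' with rfl | he'
      · simpa [h0 _ heF] using hε
      · have : e' ≠ e := fun hee => heF (hee ▸ he')
        simpa [this] using h1 e' he'
    · simp only [Pi.add_apply, mul_add, Finset.sum_add_distrib, h2]
      rw [Finset.sum_eq_single e (by intro e' _ he'; simp [he']) (by simp), hs]
      simp only [Pi.single_eq_same]
      linear_combination ((if v = x then 1 else 0) - (if v = c then 1 else 0)) * hεε

end IsPath

/-! ### Pairings of the terminals, uniqueness of `σ_P`, and the constant `c_P` -/

section Pairing

/-- The smaller elements of the orbits of a fixed-point-free involution, in increasing order, fill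
the first slots. The involution swaps them with the larger ones, so there are `k` of each. -/
theorem exists_pairingPerm {k : ℕ} (p : Fin (2 * k) → Fin (2 * k)) (hp : ∀ a, p (p a) = a)
    (hne : ∀ a, p a ≠ a) :
    ∃ σ ∈ pairingPerms k, ∀ i, σ (slot i 1) = p (σ (slot i 0)) := by
  have hinj : Function.Injective p := Function.LeftInverse.injective hp
  let S : Finset (Fin (2 * k)) := Finset.univ.filter fun a => a < p a
  have hS : S.card = k := by
    have h1 : S.image p = Sᶜ := by
      ext a
      simp only [S, Finset.mem_image, Finset.mem_filter, Finset.mem_univ, true_and,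
        Finset.mem_compl, not_lt]
      constructor
      · rintro ⟨c, hc, rfl⟩
        rw [hp]
        exact hc.le
      · intro h
        exact ⟨p a, by rw [hp]; exact lt_of_le_of_ne h (hne a), hp a⟩
    have h2 := Finset.card_add_card_compl S
    rw [← h1, Finset.card_image_of_injective _ hinj, Fintype.card_fin] at h2
    omega
  let g := S.orderEmbOfFin hS
  have hg : ∀ i, g i < p (g i) := fun i => by
    exact (Finset.mem_filter.1 (Finset.orderEmbOfFin_mem S hS i)).2
  have hgp : ∀ i j, g i ≠ p (g j) := fun i j h => by
    have h1 := hg i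
    rw [h, hp] at h1
    exact lt_asymm h1 (hg j)
  let f : Fin k × Fin 2 → Fin (2 * k) := fun r => if r.2 = 0 then g r.1 else p (g r.1)
  have hf : Function.Injective f := by
    rintro ⟨i, c⟩ ⟨j, d⟩ h
    fin_cases c <;> fin_cases d <;> simp [f] at h
    · simp [h]
    · exact absurd h (hgp i j)
    · exact absurd h.symm (hgp j i)
    · simpa using hinj h
  have hbij : Function.Bijective f :=
    (Fintype.bijective_iff_injective_and_card f).2 ⟨hf, by simp [mul_comm]⟩
  let σ := (slotEquiv k).symm.trans (Equiv.ofBijective f hbij)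
  have hσ : ∀ i j, σ (slot i j) = f (i, j) := fun i j => by
    simp [σ, ← slotEquiv_apply]
  refine ⟨σ, ⟨fun i j hij => ?_, fun i => ?_⟩, fun i => ?_⟩
  · simpa [hσ, f] using hij
  · simpa [hσ, f] using hg i
  · simp [hσ, f]

/-- A strictly increasing sequence is determined by its range, so the set of pairs already fixes the
order in which they are listed. -/
theorem pairingPerms_eq_of_pairs {k : ℕ} {σ τ : Equiv.Perm (Fin (2 * k))}
    (hσ : σ ∈ pairingPerms k) (hτ : τ ∈ pairingPerms k)
    (h : ∀ i, ∃ j, τ (slot i 0) = σ (slot j 0) ∧ τ (slot i 1) = σ (slot j 1))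
    (h' : ∀ i, ∃ j, σ (slot i 0) = τ (slot j 0) ∧ σ (slot i 1) = τ (slot j 1)) : σ = τ := by
  have h0 : (fun i => σ (slot i 0)) = fun i => τ (slot i 0) := by
    refine (StrictMono.range_inj (fun i j => hσ.1 i j) (fun i j => hτ.1 i j)).1
      (Set.Subset.antisymm ?_ ?_)
    · rintro _ ⟨i, rfl⟩
      obtain ⟨j, hj, _⟩ := h' i
      exact ⟨j, hj.symm⟩
    · rintro _ ⟨i, rfl⟩
      obtain ⟨j, hj, _⟩ := h i
      exact ⟨j, hj.symm⟩
  ext1 a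
  obtain ⟨i, j, rfl⟩ := exists_slot_eq a
  obtain ⟨i', h1, h2⟩ := h i
  have h3 : σ (slot i 0) = τ (slot i 0) := congrFun h0 i
  obtain rfl : i = i' := (slot_inj (σ.injective (h3.trans h1))).1
  fin_cases j
  exacts [h1.symm, h2.symm]

end Pairing

section ConnectsVia

variable {V E : Type*} {s k : ℕ} {G : Graph V E} {T : TerminalFamily V s k}

/-- Every edge of `P` has both ends in the same `W j`. So a path of the second decomposition stays
in the vertex set of the first-decomposition path where it starts, and that set has only two
terminals. -/
theorem ConnectsVia.exists_pair {P : Finset E}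
    {σ τ : Equiv.Perm (Fin (2 * k))} (hσ : ConnectsVia G T P σ) (hτ : ConnectsVia G T P τ)
    (i : Fin k) : ∃ j, τ (slot i 0) = σ (slot j 0) ∧ τ (slot i 1) = σ (slot j 1) := by
  obtain ⟨hσ, F, W, hF, hW, hP⟩ := hσ
  obtain ⟨hτ, F', W', hF', -, hP'⟩ := hτ
  have hterm : ∀ i j, T.term (σ (slot i j)) ∈ W i := by
    intro i j
    fin_cases j
    exacts [(hF i).2.left_mem, (hF i).2.right_mem]
  obtain ⟨j, d, hjd⟩ := exists_slot_eq (σ.symm (τ (slot i 0)))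
  obtain ⟨j', d', hjd'⟩ := exists_slot_eq (σ.symm (τ (slot i 1)))
  rw [← Equiv.symm_apply_eq, Equiv.symm_symm] at hjd hjd'
  have hclosed : ∀ e ∈ F' i, ∀ a c, G.IsLink e a c → (a ∈ W j) = (c ∈ W j) := by
    intro e he a c hl
    have heP : e ∈ ⋃ i, F i := by
      rw [← hP, hP']
      exact Set.mem_iUnion_of_mem i he
    obtain ⟨m, hm⟩ := Set.mem_iUnion.1 heP
    have ha := (hF m).2.mem_of_isLink hm hl
    have hc := (hF m).2.mem_of_isLink hm hl.symm
    by_cases hmj : m = j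
    · subst hmj
      simp [ha, hc]
    · have h1 := Set.disjoint_left.1 (hW m j hmj) ha
      have h2 := Set.disjoint_left.1 (hW m j hmj) hc
      simp [h1, h2]
  have h1 := (hF' i).2.eq_of_mem (fun a => a ∈ W j) hclosed (hF' i).2.right_mem
  rw [← hjd, ← hjd'] at h1
  have h2 : T.term (σ (slot j' d')) ∈ W j := h1.mpr (hterm j d)
  obtain rfl : j' = j := by
    by_contra hne
    exact Set.disjoint_left.1 (hW j' j hne) (hterm j' d') h2
  have hlt := hτ.2 i
  rw [← hjd, ← hjd'] at hlt
  have hlt' := hσ.2 j'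
  refine ⟨j', ?_⟩
  rw [← hjd, ← hjd']
  -- The order within each pair excludes the reversed matching, and the two ends of a pair are
  -- distinct.
  fin_cases d <;> fin_cases d'
  · exact absurd hlt (lt_irrefl _)
  · exact ⟨rfl, rfl⟩
  · exact absurd hlt' (lt_asymm hlt)
  · exact absurd hlt (lt_irrefl _)

theorem ConnectsVia.unique {P : Finset E}
    {σ τ : Equiv.Perm (Fin (2 * k))} (hσ : ConnectsVia G T P σ) (hτ : ConnectsVia G T P τ) :
    σ = τ :=
  pairingPerms_eq_of_pairs hσ.1 hτ.1 (hσ.exists_pair hτ) (hτ.exists_pair hσ)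

theorem connectsVia_pathPerm {P : Finset E} (hP : IsDisjointPath G T P) :
    ConnectsVia G T P (pathPerm G T P) := by
  rw [pathPerm, dif_pos hP]
  exact Classical.choose_spec hP

theorem ConnectsVia.label_lt {P : Finset E} {σ : Equiv.Perm (Fin (2 * k))}
    (hσ : ConnectsVia G T P σ) (i : Fin k) :
    T.label (σ (slot i 0)) < T.label (σ (slot i 1)) := by
  obtain ⟨hσ, F, W, hF, -⟩ := hσ
  exact lt_of_le_of_ne (T.label_mono (hσ.2 i).le) (hF i).1

theorem det_pair_ne_zero {K : Type*} [Field K] {u v : Fin 2 → K}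
    (h : LinearIndependent K ![u, v]) : (Matrix.of ![u, v]).det ≠ 0 := by
  have h1 : IsUnit (Matrix.of ![u, v]) := Matrix.linearIndependent_rows_iff_isUnit.1 h
  exact ((Matrix.isUnit_iff_isUnit_det _).1 h1).ne_zero

theorem pathConst_ne_zero {K : Type*} [Field K] {b : Fin s → Fin 2 → K}
    (hb : ∀ a a', a ≠ a' → LinearIndependent K ![b a, b a']) {P : Finset E}
    (hP : IsDisjointPath G T P) : pathConst G T b P ≠ 0 :=
  Finset.prod_ne_zero_iff.2 fun i _ =>
    det_pair_ne_zero (hb _ _ ((connectsVia_pathPerm hP).label_lt i).ne)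

/-- For three parts, `c_P` is determined by the sizes of the parts. -/
theorem pathConst_eq_of_three {K : Type*} [Field K] {T : TerminalFamily V 3 k}
    (b : Fin 3 → Fin 2 → K) {P Q : Finset E} (hP : IsDisjointPath G T P)
    (hQ : IsDisjointPath G T Q) : pathConst G T b P = pathConst G T b Q := by
  let d : Fin 3 → Fin 3 → K := fun a c => (Matrix.of ![b a, b c]).det
  -- `X σ a c` counts the pairs between parts `a` and `c`. Labels increase within each pair, so only
  -- `01`, `02` and `12` occur.
  let X : Equiv.Perm (Fin (2 * k)) → Fin 3 → Fin 3 → ℕ := fun σ a c =>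
    ∑ i, if T.label (σ (slot i 0)) = a ∧ T.label (σ (slot i 1)) = c then 1 else 0
  have hval : ∀ R, IsDisjointPath G T R → pathConst G T b R =
      d 0 1 ^ X (pathPerm G T R) 0 1 * d 0 2 ^ X (pathPerm G T R) 0 2 *
        d 1 2 ^ X (pathPerm G T R) 1 2 := by
    intro R hR
    have hlt := (connectsVia_pathPerm hR).label_lt
    simp only [X, ← Finset.prod_pow_eq_pow_sum, ← Finset.prod_mul_distrib, pathConst]
    refine Finset.prod_congr rfl fun i _ => ?_
    have hlt := hlt i
    change d _ _ = _
    generalize T.label (pathPerm G T R (slot i 0)) = a at hlt ⊢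
    generalize T.label (pathPerm G T R (slot i 1)) = c at hlt ⊢
    fin_cases a <;> fin_cases c <;> simp at hlt ⊢
  have hcount : ∀ (σ : Equiv.Perm (Fin (2 * k))),
      (∀ i, T.label (σ (slot i 0)) < T.label (σ (slot i 1))) →
      (∑ t, if T.label t = 0 then 1 else 0) = X σ 0 1 + X σ 0 2 ∧
      (∑ t, if T.label t = 1 then 1 else 0) = X σ 0 1 + X σ 1 2 ∧
      (∑ t, if T.label t = 2 then 1 else 0) = X σ 0 2 + X σ 1 2 := by
    intro σ hlt
    have hsum : ∀ a, (∑ t, if T.label t = a then 1 else 0) =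
        ∑ i, ((if T.label (σ (slot i 0)) = a then 1 else 0) +
          if T.label (σ (slot i 1)) = a then 1 else 0) := fun a => by
      rw [← Equiv.sum_comp σ, sum_slot]
      simp only [Fin.sum_univ_two]
    simp only [hsum, X, ← Finset.sum_add_distrib]
    refine ⟨Finset.sum_congr rfl fun i _ => ?_, Finset.sum_congr rfl fun i _ => ?_,
      Finset.sum_congr rfl fun i _ => ?_⟩ <;>
    · have hlt := hlt i
      generalize T.label (σ (slot i 0)) = a at hlt ⊢
      generalize T.label (σ (slot i 1)) = c at hlt ⊢
      fin_cases a <;> fin_cases c <;> simp at hlt ⊢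
  have h1 := hcount _ (connectsVia_pathPerm hP).label_lt
  have h2 := hcount _ (connectsVia_pathPerm hQ).label_lt
  -- The part sizes are `X01 + X02`, `X01 + X12` and `X02 + X12`; this linear system has a unique
  -- solution.
  rw [hval P hP, hval Q hQ, show X (pathPerm G T P) 0 1 = X (pathPerm G T Q) 0 1 by omega,
    show X (pathPerm G T P) 0 2 = X (pathPerm G T Q) 0 2 by omega,
    show X (pathPerm G T P) 1 2 = X (pathPerm G T Q) 1 2 by omega]

end ConnectsVia

end Mader

/-! ### The determinant formula -/

namespace Mader

open Matrix MatroidParity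
open scoped Kronecker

/-- A square matrix all of whose columns are columns of a directed incidence matrix, up to sign and
up to the deletion of rows, has determinant `0`, `1` or `-1`. -/
theorem det_sq_of_incidence_columns {K α : Type*} [Field K] [DecidableEq α] {n : ℕ} (g : Fin n → α)
    (hg : Function.Injective g) (M : Matrix (Fin n) (Fin n) K)
    (hM : ∀ c, ∃ (ε : K) (p q : α), ε * ε = 1 ∧
      ∀ i, M i c = ε * ((if g i = p then 1 else 0) - (if g i = q then 1 else 0))) :
    M.det = 0 ∨ M.det * M.det = 1 := by
  induction n with
  | zero => simp
  | succ n ih =>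
    -- If neither or both of `p`, `q` index rows present in `M`, the column sums to zero; otherwise
    -- it has a single nonzero entry, of square `1`.
    have hcol : ∀ c, ∑ i, M i c = 0 ∨ ∃ i, M i c * M i c = 1 ∧ ∀ i' ≠ i, M i' c = 0 := by
      intro c
      obtain ⟨ε, p, q, hε, hc⟩ := hM c
      have hone : ∀ i, (∑ i', if g i' = g i then (1 : K) else 0) = 1 := fun i => by
        simp [hg.eq_iff]
      by_cases hp : ∃ i, g i = p
      · obtain ⟨i, rfl⟩ := hp
        by_cases hq : ∃ i, g i = q
        · obtain ⟨j, rfl⟩ := hq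
          left
          simp only [hc, ← Finset.mul_sum, Finset.sum_sub_distrib, hone]
          simp
        · right
          push Not at hq
          exact ⟨i, by simp [hc, hq, hε], fun j hj => by simp [hc, hq, hg.eq_iff, hj]⟩
      · by_cases hq : ∃ i, g i = q
        · obtain ⟨i, rfl⟩ := hq
          right
          push Not at hp
          exact ⟨i, by simp [hc, hp, hε], fun j hj => by simp [hc, hp, hg.eq_iff, hj]⟩
        · left
          push Not at hp hq
          simp [hc, hp, hq]
    -- Either the all-ones row vector lies in the left kernel, or the determinant is expanded along
    -- a column with a single nonzero entry.
    by_cases hall : ∀ c, ∑ i, M i c = 0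
    · left
      refine exists_vecMul_eq_zero_iff.1 ⟨fun _ => 1, fun h => one_ne_zero (congrFun h 0), ?_⟩
      funext c
      simpa [vecMul, dotProduct] using hall c
    · push Not at hall
      obtain ⟨c, hc⟩ := hall
      obtain ⟨i, hi, hi'⟩ := (hcol c).resolve_left hc
      have hdet : M.det = (-1) ^ (i + c : ℕ) * M i c *
          (M.submatrix i.succAbove c.succAbove).det := by
        rw [det_succ_column M c]
        refine Finset.sum_eq_single i (fun i' _ h => ?_) (by simp)
        rw [hi' i' h]
        ring
      have hs : ((-1 : K) ^ (i + c : ℕ)) * (-1) ^ (i + c : ℕ) = 1 := by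
        rw [← mul_pow]
        simp
      rcases ih (g ∘ i.succAbove) (hg.comp Fin.succAbove_right_injective)
        (M.submatrix i.succAbove c.succAbove) (fun c' => by
          obtain ⟨ε, p, q, hε, h⟩ := hM (c.succAbove c')
          exact ⟨ε, p, q, hε, fun i' => h _⟩) with h | h
      · left
        rw [hdet, h, mul_zero]
      · right
        rw [hdet]
        linear_combination (M i c * M i c * (M.submatrix i.succAbove c.succAbove).det *
          (M.submatrix i.succAbove c.succAbove).det) * hs +
          (M.submatrix i.succAbove c.succAbove).det *
          (M.submatrix i.succAbove c.succAbove).det * hi + h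

/-- Serves to list the lines of a base so that one chosen edge of each path takes the positions of
`Fin k`, which makes the later change of columns block triangular. -/
theorem exists_equiv_extending {α β γ : Type*} [Fintype α] [Fintype β] (e : α ⊕ β ≃ γ)
    (f : α → γ) (hf : Function.Injective f) : ∃ e' : α ⊕ β ≃ γ, ∀ a, e' (Sum.inl a) = f a := by
  classical
  have : Fintype γ := Fintype.ofEquiv _ e
  have h : Fintype.card β = Fintype.card ((Set.range f)ᶜ : Set γ) := by
    rw [Fintype.card_compl_set, Set.card_range_of_injective hf, ← Fintype.card_congr e,
      Fintype.card_sum]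
    omega
  obtain ⟨e₂⟩ := Fintype.card_eq.1 h
  exact ⟨((Equiv.ofInjective f hf).sumCongr e₂).trans (Equiv.Set.sumCompl (Set.range f)),
    fun a => rfl⟩

variable {V E K : Type*} [Fintype V] [DecidableEq V] [Field K] {s k : ℕ} {G : Graph V E}

theorem det_sq_signedInc (T : TerminalFamily V s k) (o : Orientation (starGraph G T))
    (hE : G.edgeSet = Set.univ) (hloop : G.Loopless)
    (hT : ∀ e i j, ¬ G.IsLink e (T.term i) (T.term j)) (a : T.Free → E ⊕ T.Free) :
    (Matrix.of fun v w : T.Free => signedInc T o K v.1 (a w)).det = 0 ∨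
    (Matrix.of fun v w : T.Free => signedInc T o K v.1 (a w)).det *
    (Matrix.of fun v w : T.Free => signedInc T o K v.1 (a w)).det = 1 := by
  have e := Fintype.equivFin T.Free
  rw [← det_submatrix_equiv_self e.symm]
  refine det_sq_of_incidence_columns (fun i => some (e.symm i).1) (fun i j h => ?_) _ fun c => ?_
  · exact e.symm.injective (Subtype.ext (Option.some_injective _ h))
  · simp only [submatrix_apply, of_apply]
    rcases a (e.symm c) with a | v
    · obtain ⟨x, z, hl⟩ := G.exists_isLink_of_mem_edgeSet (e := a) (by rw [hE]; trivial)
      obtain ⟨ε, hε, h⟩ := signedInc_inl (K := K) T o hloop hT hl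
      exact ⟨ε, some x, some z, by rcases hε with rfl | rfl <;> simp, fun i => by simp [h]⟩
    · obtain ⟨ε, hε, h⟩ := signedInc_inr (K := K) T o v
      -- `none` stands for the new vertex `v*`, whose row is deleted.
      exact ⟨ε, some v.1, none, by rcases hε with rfl | rfl <;> simp, fun i => by simp [h]⟩

/-- The determinant of the terminal rows after the reduction along the paths. -/
theorem det_terminal_block (σ : Equiv.Perm (Fin (2 * k))) (u : Fin (2 * k) → Fin 2 → K) :
    (Matrix.of fun r c : Fin k × Fin 2 => - ((if slot r.1 r.2 = σ (slot c.1 0) then 1 else 0) -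
      (if slot r.1 r.2 = σ (slot c.1 1) then 1 else 0)) * u (slot r.1 r.2) c.2).det =
    (-1) ^ k * (∏ i, (Matrix.of ![u (σ (slot i 0)), u (σ (slot i 1))]).det) *
      ((Equiv.Perm.sign σ : ℤ) : K) := by
  let Q : Matrix (Fin k × Fin 2) (Fin k × Fin 2) K := Matrix.of fun r c =>
    - ((if slot r.1 r.2 = σ (slot c.1 0) then 1 else 0) -
      (if slot r.1 r.2 = σ (slot c.1 1) then 1 else 0)) * u (slot r.1 r.2) c.2
  change Q.det = _
  let π : Equiv.Perm (Fin k × Fin 2) := (slotEquiv k).symm.permCongr σ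
  have hπ : ∀ r, slotEquiv k (π r) = σ (slotEquiv k r) := fun r => by
    simp [π, Equiv.permCongr_apply]
  have hsign : Equiv.Perm.sign π = Equiv.Perm.sign σ := Equiv.Perm.sign_permCongr _ _
  have hperm := det_permute π Q
  -- Permuting the rows by `σ` brings the two ends of each path together. Each diagonal block has
  -- its first row negated, which yields the factor `(-1)^k`.
  have hblock : Q.submatrix π id = (blockDiagonal fun i : Fin k =>
      Matrix.of ![- u (σ (slot i 0)), u (σ (slot i 1))]).submatrix
        (Equiv.prodComm _ _) (Equiv.prodComm _ _) := by
    ext ⟨i, j⟩ ⟨i', c⟩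
    have h : slot (π (i, j)).1 (π (i, j)).2 = σ (slot i j) := by
      rw [← slotEquiv_apply, ← slotEquiv_apply, ← hπ]
    have hs : ∀ d, slot i j = slot i' d ↔ i = i' ∧ j = d := fun d =>
      ⟨slot_inj, by rintro ⟨rfl, rfl⟩; rfl⟩
    simp only [Q, submatrix_apply, of_apply, id, h, σ.injective.eq_iff, blockDiagonal_apply,
      Equiv.prodComm_apply, Prod.swap, hs]
    by_cases hi : i = i'
    · subst hi
      fin_cases j <;> simp
    · simp [hi]
  have hdet : ∀ v w : Fin 2 → K,
      (Matrix.of ![-v, w]).det = -1 * (Matrix.of ![v, w]).det := fun v w => by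
    simp [det_fin_two]
    ring
  rw [hblock, det_submatrix_equiv_self, det_blockDiagonal, hsign] at hperm
  simp only [hdet, Finset.prod_mul_distrib, Finset.prod_const, Finset.card_univ,
    Fintype.card_fin] at hperm
  have hsq : ((Equiv.Perm.sign σ : ℤ) : K) * ((Equiv.Perm.sign σ : ℤ) : K) = 1 := by
    rcases Int.units_eq_one_or (Equiv.Perm.sign σ) with h | h <;> simp [h]
  rw [hperm]
  linear_combination (-Q.det) * hsq

/-- The determinant formula. -/
theorem detLines_eq_of_connectsVia [Fintype E] {T : TerminalFamily V s k}
    {o : Orientation (starGraph G T)} {b : Fin s → Fin 2 → K}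
    (hE : G.edgeSet = Set.univ) (hloop : G.Loopless)
    (hT : ∀ e i j, ¬ G.IsLink e (T.term i) (T.term j))
    {P : Finset E} {B : Finset (E ⊕ T.Free)} {σ : Equiv.Perm (Fin (2 * k))}
    (hσ : ConnectsVia G T P σ) (hB : IsParityBase (yamaguchiMatrix G T o b) B)
    (hPB : P ⊆ B.toLeft) :
    detLines (yamaguchiMatrix G T o b) B = (-1) ^ k *
      (∏ i, (Matrix.of ![b (T.label (σ (slot i 0))), b (T.label (σ (slot i 1)))]).det) *
      ((Equiv.Perm.sign σ : ℤ) : K) := by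
  obtain ⟨hσ, F, W, hF, hW, hP⟩ := hσ
  have hne : ∀ i, T.term (σ (slot i 0)) ≠ T.term (σ (slot i 1)) := fun i h =>
    (hσ.2 i).ne (T.term_injective h)
  have hFB : ∀ i, ∀ a ∈ F i, Sum.inl a ∈ B := fun i a ha => by
    have : a ∈ P := by
      rw [← Finset.mem_coe, hP]
      exact Set.mem_iUnion_of_mem i ha
    simpa using hPB this
  -- `f i` is the edge of the `i`-th path whose columns will be replaced by the flow along that
  -- path.
  choose f hf using fun i => (hF i).2.nonempty (hne i)
  choose Z hZ0 hZ1 hZ using fun i => (hF i).2.exists_flow (K := K) T o hloop hT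
  have hfF : ∀ i j, i ≠ j → f i ∉ F j := by
    intro i j hij h
    obtain ⟨x, z, hl⟩ := G.exists_isLink_of_mem_edgeSet (e := f i) (by rw [hE]; trivial)
    exact Set.disjoint_left.1 (hW i j hij) ((hF i).2.mem_of_isLink (hf i) hl)
      ((hF j).2.mem_of_isLink h hl)
  have hfinj : Function.Injective f := fun i j h => by
    by_contra hij
    exact hfF i j hij (h ▸ hf j)
  obtain ⟨e₀⟩ := exists_listing T hB.1
  obtain ⟨e, he⟩ := exists_equiv_extending e₀ (fun i => ⟨Sum.inl (f i), hFB i _ (hf i)⟩)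
    (fun i j h => hfinj (by simpa using h))
  rw [detLines_eq _ e]
  rw [isParityBase_iff_det T o b e] at hB
  set M := lineSubmatrix (yamaguchiMatrix G T o b) e with hM
  let Y : Fin k → E ⊕ T.Free → K := fun j => Sum.elim (Z j) 0
  have hY : ∀ j x, ∑ r, signedInc T o K x (e r) * Y j (e r) =
      (if x = T.term (σ (slot j 0)) then 1 else 0) -
        (if x = T.term (σ (slot j 1)) then 1 else 0) := by
    intro j x
    rw [sum_lines T e (fun a => signedInc T o K x a * Y j a), Fintype.sum_sum_type, ← hZ j x]
    · simp [Y]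
    · rintro (a | v) ha
      · have : a ∉ F j := fun h => ha (hFB j a h)
        simp [Y, hZ0 j a this]
      · simp [Y]
  -- Right multiplication by `R` replaces the column of `f i` by the unit flow along the `i`-th
  -- path. Because `f i` lies on no other path, the upper left block is diagonal with entries `±1`.
  let R : Matrix (Fin k ⊕ T.Free) (Fin k ⊕ T.Free) K :=
    fromBlocks (Matrix.of fun i j => Y j (e (Sum.inl i))) 0
      (Matrix.of fun v j => Y j (e (Sum.inr v))) 1
  have hRl : ∀ r j, R r (Sum.inl j) = Y j (e r) := by
    rintro (i | v) j <;> rfl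
  have hRr : ∀ r w, R r (Sum.inr w) = if r = Sum.inr w then 1 else 0 := by
    rintro (i | v) w <;> simp [R, Matrix.one_apply]
  have hR : R.det * R.det = 1 := by
    have h1 : R.det = ∏ i, Z i (f i) := by
      rw [det_fromBlocks_zero₁₂, det_one, mul_one, ← det_diagonal]
      congr 1
      ext i j
      by_cases hij : i = j
      · subst hij
        simp [he, Y]
      · simp [he, Y, hij, hZ0 j (f i) (hfF i j hij)]
    rw [h1, ← Finset.prod_mul_distrib]
    refine Finset.prod_eq_one fun i _ => ?_
    rcases hZ1 i (f i) (hf i) with h | h <;> simp [h]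
  let N : Matrix T.Free T.Free K := Matrix.of fun v w => signedInc T o K v.1 (e (Sum.inr w))
  let Q : Matrix (Fin k × Fin 2) (Fin k × Fin 2) K := Matrix.of fun r c =>
    - ((if slot r.1 r.2 = σ (slot c.1 0) then 1 else 0) -
      (if slot r.1 r.2 = σ (slot c.1 1) then 1 else 0)) * b (T.label (slot r.1 r.2)) c.2
  let δ := Equiv.sumProdDistrib (Fin k) T.Free (Fin 2)
  have hprod : ∀ r j r' c, (M * (R ⊗ₖ (1 : Matrix (Fin 2) (Fin 2) K))) (r, j) (r', c) =
      ∑ r'', M (r, j) (r'', c) * R r'' r' := by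
    intro r j r' c
    rw [mul_apply, Fintype.sum_prod_type]
    refine Finset.sum_congr rfl fun r'' _ => ?_
    simp [kroneckerMap_apply, Matrix.one_apply]
  -- The lower left block vanishes since the flows are conserved at non-terminals; at the terminals
  -- only the ends of the paths survive.
  have hblocks : (M * (R ⊗ₖ (1 : Matrix (Fin 2) (Fin 2) K))).submatrix δ.symm δ.symm =
      fromBlocks Q (Matrix.of fun r c => M (Sum.inl r.1, r.2) (Sum.inr c.1, c.2)) 0
        (N ⊗ₖ (1 : Matrix (Fin 2) (Fin 2) K)) := by
    ext r c
    obtain ⟨i, j⟩ | ⟨v, j⟩ := r <;> obtain ⟨i', c⟩ | ⟨w, c⟩ := c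
    · change (M * (R ⊗ₖ (1 : Matrix (Fin 2) (Fin 2) K))) (Sum.inl i, j) (Sum.inl i', c) = _
      rw [hprod]
      simp only [hRl, fromBlocks_apply₁₁, Q, of_apply]
      have := hY i' (T.term (slot i j))
      simp only [T.term_injective.eq_iff] at this
      rw [← this, ← Finset.sum_neg_distrib, Finset.sum_mul]
      refine Finset.sum_congr rfl fun r _ => ?_
      change yamaguchiMatrix G T o b (Sum.inl i, j) ((e r : E ⊕ T.Free), c) * _ = _
      rw [yamaguchiMatrix_inl]
      ring
    · change (M * (R ⊗ₖ (1 : Matrix (Fin 2) (Fin 2) K))) (Sum.inl i, j) (Sum.inr w, c) = _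
      rw [hprod]
      simp [hRr]
    · change (M * (R ⊗ₖ (1 : Matrix (Fin 2) (Fin 2) K))) (Sum.inr v, j) (Sum.inl i', c) = 0
      rw [hprod]
      simp only [hRl]
      have := hY i' v.1
      rw [if_neg (fun h => v.2 _ h.symm), if_neg (fun h => v.2 _ h.symm), sub_zero] at this
      rw [← mul_zero ((1 : Matrix (Fin 2) (Fin 2) K) j c), ← this, Finset.mul_sum]
      refine Finset.sum_congr rfl fun r _ => ?_
      change yamaguchiMatrix G T o b (Sum.inr v, j) ((e r : E ⊕ T.Free), c) * _ = _
      rw [yamaguchiMatrix_inr]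
      ring
    · change (M * (R ⊗ₖ (1 : Matrix (Fin 2) (Fin 2) K))) (Sum.inr v, j) (Sum.inr w, c) = _
      rw [hprod]
      simp only [hRr, mul_ite, mul_one, mul_zero, Finset.sum_ite_eq', Finset.mem_univ, if_true]
      exact yamaguchiMatrix_inr T o b v j c _
  have hdet := congrArg det hblocks
  rw [det_submatrix_equiv_self, det_mul, det_kronecker, det_fromBlocks_zero₂₁, det_kronecker]
    at hdet
  simp only [det_one, one_pow, mul_one, Fintype.card_fin, pow_two, hR] at hdet
  -- `N` enters through `N ⊗ I₂`, so only `(det N)²` matters. The value `0` is excluded because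
  -- `A[B]` is nonsingular.
  rcases det_sq_signedInc (K := K) T o hE hloop hT (fun w => (e (Sum.inr w) : E ⊕ T.Free))
    with h | h
  · change N.det = 0 at h
    rw [h, mul_zero, mul_zero] at hdet
    exact absurd hdet hB
  · change N.det * N.det = 1 at h
    rw [h, mul_one] at hdet
    rw [hdet]
    exact det_terminal_block σ fun a => b (T.label a)

end Mader

/-! ### Components of a parity base, and the passage between bases and paths -/

namespace Mader

open MatroidParity

variable {V E K : Type*} [Fintype V] [DecidableEq V] [Fintype E] [Field K] {s k : ℕ}
  {G : Graph V E} {T : TerminalFamily V s k} {o : Orientation (starGraph G T)}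
  {b : Fin s → Fin 2 → K}

theorem Joined.exists_flow (hV : G.vertexSet = Set.univ) (hloop : G.Loopless)
    (hT : ∀ e i j, ¬ G.IsLink e (T.term i) (T.term j)) {B : Finset (E ⊕ T.Free)} {x y : V}
    (h : Joined G {e | Sum.inl e ∈ B} x y) :
    ∃ Z : E ⊕ T.Free → K, (∀ e, e ∉ B → Z e = 0) ∧
      ∀ v, ∑ e, signedInc T o K v e * Z e =
        (if v = x then 1 else 0) - (if v = y then 1 else 0) := by
  obtain ⟨F, W, hF, p⟩ := h.exists_isPath hV
  obtain ⟨Z, h0, -, hZ⟩ := p.exists_flow (K := K) T o hloop hT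
  refine ⟨Sum.elim Z 0, ?_, fun v => ?_⟩
  · rintro (e | v) he
    · exact h0 e fun h => he (hF h)
    · rfl
  · rw [Fintype.sum_sum_type, ← hZ v]
    simp

/-- A component of a parity base contains at most two terminals. -/
theorem false_of_three_joined_terminals (hV : G.vertexSet = Set.univ) (hloop : G.Loopless)
    (hT : ∀ e i j, ¬ G.IsLink e (T.term i) (T.term j)) {B : Finset (E ⊕ T.Free)}
    (hB : IsParityBase (yamaguchiMatrix G T o b) B) {i₁ i₂ i₃ : Fin (2 * k)}
    (h12 : i₁ ≠ i₂) (h13 : i₁ ≠ i₃) (h23 : i₂ ≠ i₃)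
    (h2 : Joined G {e | Sum.inl e ∈ B} (T.term i₁) (T.term i₂))
    (h3 : Joined G {e | Sum.inl e ∈ B} (T.term i₁) (T.term i₃)) : False := by
  obtain ⟨Y, hY0, hY⟩ := h2.exists_flow (K := K) (o := o) hV hloop hT
  obtain ⟨Z, hZ0, hZ⟩ := h3.exists_flow (K := K) (o := o) hV hloop hT
  -- The flows to `i₂` and `i₃` get vector coefficients `a`, `a'`: four unknowns against three
  -- orthogonality conditions, so a nonzero choice exists.
  let f : (Fin 2 → K) × (Fin 2 → K) →ₗ[K] (Fin 3 → K) :=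
    { toFun := fun a => ![∑ c, b (T.label i₁) c * (a.1 c + a.2 c),
        ∑ c, b (T.label i₂) c * a.1 c, ∑ c, b (T.label i₃) c * a.2 c]
      map_add' := fun a a' => by
        ext i
        fin_cases i <;> simp [Fin.sum_univ_two] <;> ring
      map_smul' := fun t a => by
        ext i
        fin_cases i <;> simp [Fin.sum_univ_two] <;> ring }
  have hf : LinearMap.ker f ≠ ⊥ := f.ker_ne_bot_of_finrank_lt (by simp)
  obtain ⟨⟨a, a'⟩, ha, hne⟩ := (Submodule.ne_bot_iff _).1 hf
  have ha0 : ∑ c, b (T.label i₁) c * (a c + a' c) = 0 := congrFun ha 0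
  have ha1 : ∑ c, b (T.label i₂) c * a c = 0 := congrFun ha 1
  have ha2 : ∑ c, b (T.label i₃) c * a' c = 0 := congrFun ha 2
  have hsum : ∀ v c, ∑ e, signedInc T o K v e * (Y e * a c + Z e * a' c) =
      ((if v = T.term i₁ then 1 else 0) - (if v = T.term i₂ then 1 else 0)) * a c +
        ((if v = T.term i₁ then 1 else 0) - (if v = T.term i₃ then 1 else 0)) * a' c := by
    intro v c
    rw [← hY, ← hZ, Finset.sum_mul, Finset.sum_mul, ← Finset.sum_add_distrib]
    exact Finset.sum_congr rfl fun e _ => by ring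
  have hzero := rightKernel_eq_zero T o b hB (fun e c => Y e * a c + Z e * a' c)
    (fun e he => by funext c; simp [hY0 e he, hZ0 e he])
    (fun v c => by
      rw [hsum]
      simp [(v.2 _).symm])
    (fun i => by
      simp only [hsum, T.term_injective.eq_iff]
      by_cases hi1 : i = i₁
      · subst hi1
        simpa [h12, h13] using ha0
      by_cases hi2 : i = i₂
      · subst hi2
        rw [Fin.sum_univ_two] at ha1 ⊢
        simp only [h12.symm, h23, if_true, if_false]
        linear_combination -ha1
      by_cases hi3 : i = i₃
      · subst hi3
        rw [Fin.sum_univ_two] at ha2 ⊢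
        simp only [h13.symm, h23.symm, if_true, if_false]
        linear_combination -ha2
      simp [hi1, hi2, hi3])
  have hall : ∀ v c, ((if v = T.term i₁ then 1 else 0) - (if v = T.term i₂ then 1 else 0)) * a c +
        ((if v = T.term i₁ then 1 else 0) - (if v = T.term i₃ then 1 else 0)) * a' c = 0 := by
    intro v c
    rw [← hsum]
    exact Finset.sum_eq_zero fun e _ => by rw [show Y e * a c + Z e * a' c = 0 from
      congrFun (congrFun hzero e) c, mul_zero]
  -- Only the first flow has nonzero excess at `i₂` and only the second at `i₃`, so a vanishing
  -- combination forces `a = a' = 0`.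
  refine hne (Prod.ext (funext fun c => ?_) (funext fun c => ?_))
  · simpa [T.term_injective.eq_iff, h12.symm, h23] using hall (T.term i₂) c
  · simpa [T.term_injective.eq_iff, h13.symm, h23.symm] using hall (T.term i₃) c

/-- In a parity base, a component that contains a terminal contains no new edge. -/
theorem not_joined_of_inr_mem (hV : G.vertexSet = Set.univ) (hloop : G.Loopless)
    (hT : ∀ e i j, ¬ G.IsLink e (T.term i) (T.term j)) {B : Finset (E ⊕ T.Free)}
    (hB : IsParityBase (yamaguchiMatrix G T o b) B) {i : Fin (2 * k)} {v : T.Free}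
    (hv : Sum.inr v ∈ B) : ¬ Joined G {e | Sum.inl e ∈ B} (T.term i) v.1 := by
  classical
  intro h
  obtain ⟨Y, hY0, hY⟩ := h.exists_flow (K := K) (o := o) hV hloop hT
  obtain ⟨ε, hε, hs⟩ := signedInc_inr (K := K) T o v
  have hεε : ε * ε = 1 := by rcases hε with rfl | rfl <;> simp
  -- Two unknowns and one condition: some nonzero `a` is orthogonal to the vector of the terminal.
  let f : (Fin 2 → K) →ₗ[K] (Fin 1 → K) :=
    { toFun := fun a _ => ∑ c, b (T.label i) c * a c
      map_add' := fun a a' => by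
        ext
        simp [Fin.sum_univ_two]
        ring
      map_smul' := fun t a => by
        ext
        simp [Fin.sum_univ_two]
        ring }
  have hf : LinearMap.ker f ≠ ⊥ := f.ker_ne_bot_of_finrank_lt (by simp)
  obtain ⟨a, ha, hne⟩ := (Submodule.ne_bot_iff _).1 hf
  have ha0 : ∑ c, b (T.label i) c * a c = 0 := congrFun ha 0
  -- The flow from the terminal to `v` is drained through the new edge at `v`, so the terminal is
  -- the only vertex with nonzero excess.
  let Z : E ⊕ T.Free → K := fun e => Y e + if e = Sum.inr v then ε else 0
  have hZ : ∀ x, ∑ e, signedInc T o K x e * Z e = if x = T.term i then 1 else 0 := by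
    intro x
    simp only [Z, mul_add, Finset.sum_add_distrib, hY]
    simp only [mul_ite, mul_zero, Finset.sum_ite_eq', Finset.mem_univ, if_true, hs]
    split_ifs <;> simp [hεε]
  have hsum : ∀ x c, ∑ e, signedInc T o K x e * (Z e * a c) =
      (if x = T.term i then 1 else 0) * a c := by
    intro x c
    rw [← hZ, Finset.sum_mul]
    exact Finset.sum_congr rfl fun e _ => by ring
  have hzero := rightKernel_eq_zero T o b hB (fun e c => Z e * a c)
    (fun e he => by
      have : e ≠ Sum.inr v := fun h => he (h ▸ hv)
      funext c
      simp [Z, hY0 e he, this])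
    (fun v c => by
      rw [hsum]
      simp [(v.2 _).symm])
    (fun j => by
      simp only [hsum, T.term_injective.eq_iff]
      by_cases hj : j = i
      · subst hj
        simpa using ha0
      · simp [hj])
  refine hne (funext fun c => ?_)
  have h1 := hsum (T.term i) c
  rw [if_pos rfl, one_mul] at h1
  rw [← h1]
  exact Finset.sum_eq_zero fun e _ => by
    rw [show Z e * a c = 0 from congrFun (congrFun hzero e) c, mul_zero]

/-- In a parity base, every terminal is joined to a terminal of another part. -/
theorem exists_joined_label_ne (hV : G.vertexSet = Set.univ) (hE : G.edgeSet = Set.univ)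
    (hloop : G.Loopless) (hT : ∀ e i j, ¬ G.IsLink e (T.term i) (T.term j))
    {B : Finset (E ⊕ T.Free)} (hB : IsParityBase (yamaguchiMatrix G T o b) B) (i : Fin (2 * k)) :
    ∃ j, T.label i ≠ T.label j ∧ Joined G {e | Sum.inl e ∈ B} (T.term i) (T.term j) := by
  classical
  by_contra! hcon
  have hlabel : ∀ j, Joined G {e | Sum.inl e ∈ B} (T.term i) (T.term j) →
      T.label i = T.label j := fun j hj => by
    by_contra h
    exact hcon j h hj
  -- If all terminals joined to `i` had its label, the potential equal to `b (T.label i)` on its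
  -- component and `0` elsewhere would be admissible: that component contains no new edge.
  have := ((isParityBase_iff T o b hE hloop hT B).1 hB).2
    (fun z => if Joined G {e | Sum.inl e ∈ B} (T.term i) z then b (T.label i) else 0)
    (fun j => if Joined G {e | Sum.inl e ∈ B} (T.term i) (T.term j) then 1 else 0)
    (fun j => by
      split_ifs with h
      · rw [hlabel j h, one_smul]
      · rw [zero_smul])
    (fun e x z he hl => by
      have h : Joined G {e | Sum.inl e ∈ B} (T.term i) x ↔
          Joined G {e | Sum.inl e ∈ B} (T.term i) z :=
        ⟨fun h => h.tail ⟨e, he, hl⟩, fun h => h.tail ⟨e, he, hl.symm⟩⟩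
      simp only [h])
    (fun v hv => if_neg (not_joined_of_inr_mem hV hloop hT hB hv))
  have h1 := congrFun this.1 i
  rw [if_pos (show Joined G _ _ _ from .refl)] at h1
  exact one_ne_zero h1

/-- Every parity base contains a disjoint `𝒮`-path. -/
theorem exists_isDisjointPath_of_isParityBase (hV : G.vertexSet = Set.univ)
    (hE : G.edgeSet = Set.univ) (hloop : G.Loopless)
    (hT : ∀ e i j, ¬ G.IsLink e (T.term i) (T.term j))
    {B : Finset (E ⊕ T.Free)} (hB : IsParityBase (yamaguchiMatrix G T o b) B) :
    ∃ P, IsDisjointPath G T P ∧ P ⊆ B.toLeft := by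
  classical
  choose p hp hpj using exists_joined_label_ne hV hE hloop hT hB
  have hne : ∀ i, p i ≠ i := fun i h => hp i (by rw [h])
  -- Otherwise `i`, `p i` and `p (p i)` would be three terminals in one component.
  have hpp : ∀ i, p (p i) = i := fun i => by
    by_contra h
    exact false_of_three_joined_terminals hV hloop hT hB (hne i).symm (Ne.symm h) (hne (p i)).symm
      (hpj i) ((hpj i).trans (hpj (p i)))
  obtain ⟨σ, hσ, hσp⟩ := exists_pairingPerm p hpp hne
  choose F W hF hpath using fun i : Fin k => (hpj (σ (slot i 0))).exists_isPath hV
  refine ⟨Finset.univ.filter fun e => ∃ i, e ∈ F i, ⟨σ, hσ, F, W, fun i => ?_, ?_, ?_⟩, ?_⟩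
  · rw [hσp]
    exact ⟨hp _, hpath i⟩
  · intro i j hij
    refine Set.disjoint_left.2 fun w hi hj => ?_
    -- A common vertex would put a third terminal into the component of the `i`-th pair.
    have hw : Joined G {e | Sum.inl e ∈ B} (T.term (σ (slot i 0))) (T.term (σ (slot j 0))) :=
      ((hpath i).joined (hF i) hi).trans ((hpath j).joined (hF j) hj).symm
    have hs : ∀ d, σ (slot i d) ≠ σ (slot j 0) := fun d h =>
      hij (slot_inj (σ.injective h)).1
    refine false_of_three_joined_terminals hV hloop hT hB (hne (σ (slot i 0))).symm (hs 0) ?_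
      (hpj _) hw
    rw [← hσp]
    exact hs 1
  · ext e
    simp
  · intro e he
    obtain ⟨i, hi⟩ := (Finset.mem_filter.1 he).2
    simpa using hF i hi

/-- The parity bases that arise from a disjoint `𝒮`-path by adding new edges only: there is exactly
one, given by the non-terminals off the path. -/
theorem isParityBase_iff_toRight_eq (hE : G.edgeSet = Set.univ) (hloop : G.Loopless)
    (hT : ∀ e i j, ¬ G.IsLink e (T.term i) (T.term j))
    (hb : ∀ a a', a ≠ a' → LinearIndependent K ![b a, b a'])
    {P : Finset E} (hP : IsDisjointPath G T P) :
    ∃ S : Finset T.Free, ∀ B : Finset (E ⊕ T.Free), B.toLeft = P →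
      (IsParityBase (yamaguchiMatrix G T o b) B ↔ B.toRight = S) := by
  classical
  obtain ⟨σ, hσ, F, W, hF, hW, hP⟩ := hP
  let U : Set V := ⋃ i, W i
  have hFP : ∀ i, ∀ e ∈ F i, e ∈ P := fun i e he => by
    rw [← Finset.mem_coe, hP]
    exact Set.mem_iUnion_of_mem i he
  have hterm : ∀ i j, T.term (σ (slot i j)) ∈ W i := by
    intro i j
    fin_cases j
    exacts [(hF i).2.left_mem, (hF i).2.right_mem]
  have htermU : ∀ a, T.term a ∈ U := by
    intro a
    obtain ⟨i, j, hij⟩ := exists_slot_eq (σ.symm a)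
    rw [← Equiv.symm_apply_eq, Equiv.symm_symm] at hij
    exact Set.mem_iUnion.2 ⟨i, hij ▸ hterm i j⟩
  have hFdisj : ∀ i j, i ≠ j → Disjoint (F i).toFinset (F j).toFinset := by
    refine fun i j hij => Finset.disjoint_left.2 fun e hi hj => ?_
    rw [Set.mem_toFinset] at hi hj
    obtain ⟨x, z, hl⟩ := G.exists_isLink_of_mem_edgeSet (e := e) (by rw [hE]; trivial)
    exact Set.disjoint_left.1 (hW i j hij) ((hF i).2.mem_of_isLink hi hl)
      ((hF j).2.mem_of_isLink hj hl)
  let S : Finset T.Free := Finset.univ.filter fun v => v.1 ∉ U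
  -- Each path has one vertex more than edges, so `P` has `|U| - k` edges. As `U` contains all `2k`
  -- terminals, this is `k` plus the number of non-terminals on the paths.
  have hcard : P.card + S.card = Fintype.card (Fin k ⊕ T.Free) := by
    have hP' : P = Finset.univ.biUnion fun i => (F i).toFinset := by
      ext e
      rw [← Finset.mem_coe, hP]
      simp
    have hU' : (Finset.univ.filter fun x => x ∈ U) =
        Finset.univ.biUnion fun i => (W i).toFinset := by
      ext x
      simp [U]
    have h1 : P.card = ∑ i, (F i).toFinset.card := by
      rw [hP']
      exact Finset.card_biUnion fun i _ j _ hij => hFdisj i j hij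
    have h2 : (Finset.univ.filter fun x => x ∈ U).card = ∑ i, (W i).toFinset.card := by
      rw [hU']
      exact Finset.card_biUnion fun i _ j _ hij => by
        simpa using hW i j hij
    have h3 : ∑ i, (W i).toFinset.card = (∑ i, (F i).toFinset.card) + k := by
      have : ∀ i, (W i).toFinset.card = (F i).toFinset.card + 1 := fun i => by
        rw [← Set.ncard_eq_toFinset_card', ← Set.ncard_eq_toFinset_card', ((hF i).2.ncard).2]
      simp [this, Finset.sum_add_distrib]
    have h4 : (Finset.univ.filter fun x => x ∈ U).card =
        2 * k + (Finset.univ.filter fun v : T.Free => v.1 ∈ U).card := by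
      rw [Finset.card_filter, T.sum_eq, Finset.card_filter]
      simp [htermU]
    have h5 : (Finset.univ.filter fun v : T.Free => v.1 ∈ U).card + S.card =
        Fintype.card T.Free :=
      Finset.card_filter_add_card_filter_not _
    rw [Fintype.card_sum, Fintype.card_fin]
    omega
  refine ⟨S, fun B hBP => ?_⟩
  have hBcard := B.card_toLeft_add_card_toRight
  rw [hBP] at hBcard
  have hinl : ∀ e, Sum.inl e ∈ B ↔ e ∈ P := fun e => by simp [← hBP]
  rw [isParityBase_iff T o b hE hloop hT]
  constructor
  · rintro ⟨hB, hker⟩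
    refine (Finset.eq_of_subset_of_card_le (fun v hv => ?_) (by omega)).symm
    have hvU : v.1 ∉ U := (Finset.mem_filter.1 hv).2
    by_contra hvB
    -- For a vertex `v` off the paths whose new edge is missing, the indicator of `v` is an
    -- admissible nonzero potential. This gives one inclusion, and the cardinalities give equality.
    have := (hker (fun z => if z = v.1 then 1 else 0) 0
      (fun a => by rw [if_neg (v.2 a)]; simp)
      (fun e x z he hl => by
        rw [hinl, ← Finset.mem_coe, hP] at he
        obtain ⟨i, hi⟩ := Set.mem_iUnion.1 he
        have hx : x ≠ v.1 := fun h =>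
          hvU (h ▸ Set.mem_iUnion.2 ⟨i, (hF i).2.mem_of_isLink hi hl⟩)
        have hz : z ≠ v.1 := fun h =>
          hvU (h ▸ Set.mem_iUnion.2 ⟨i, (hF i).2.mem_of_isLink hi hl.symm⟩)
        simp [hx, hz])
      (fun w hw => by
        have : w.1 ≠ v.1 := fun h => hvB (by
          rw [Finset.mem_toRight, ← Subtype.ext h]
          exact hw)
        simp [this])).2 v
    rw [if_pos rfl] at this
    exact one_ne_zero (congrFun this 0)
  · intro hS
    refine ⟨by rw [← hBcard, hS, hcard], fun φ y hφ hlink hstar => ?_⟩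
    have hconst : ∀ i, ∀ w ∈ W i, φ w = φ (T.term (σ (slot i 0))) := fun i w hw =>
      (hF i).2.eq_of_mem φ
        (fun e he a c hl => hlink e a c ((hinl e).2 (hFP i e he)) hl) hw
    have hy : ∀ i, y (σ (slot i 0)) = 0 ∧ y (σ (slot i 1)) = 0 := by
      intro i
      -- The potential is constant along the path, so multiples of two linearly independent vectors
      -- coincide and both coefficients are zero.
      have h1 := hconst i _ (hterm i 1)
      rw [hφ, hφ] at h1
      have h2 := LinearIndependent.pair_iff.1 (hb _ _ (hF i).1) (y (σ (slot i 0)))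
        (- y (σ (slot i 1))) (by rw [neg_smul, h1, add_neg_cancel])
      simpa using h2
    refine ⟨funext fun a => ?_, fun v => ?_⟩
    · obtain ⟨i, j, hij⟩ := exists_slot_eq (σ.symm a)
      rw [← Equiv.symm_apply_eq, Equiv.symm_symm] at hij
      rw [← hij]
      fin_cases j
      exacts [(hy i).1, (hy i).2]
    · by_cases hv : v.1 ∈ U
      · obtain ⟨i, hi⟩ := Set.mem_iUnion.1 hv
        rw [hconst i _ hi, hφ, (hy i).1, zero_smul]
      · refine hstar v ?_
        rw [← Finset.mem_toRight, hS]
        exact Finset.mem_filter.2 ⟨Finset.mem_univ _, hv⟩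

omit [Fintype V] [DecidableEq V] [Fintype E] in
theorem sum_starWeight (l : E → ℝ) (B : Finset (E ⊕ T.Free)) :
    ∑ e ∈ B, starWeight T l e = ∑ e ∈ B.toLeft, l e := by
  conv_lhs => rw [← Finset.toLeft_disjSum_toRight (u := B)]
  rw [Finset.sum_disjSum]
  simp [starWeight]

end Mader

/-! ### Assembly of the main theorem -/

theorem mainTheorem10 {V E K : Type*} [Fintype V] [DecidableEq V] [Fintype E] [Field K]
    -- a finite loopless graph with vertex set `V` and edge set `E`
    (G : Graph V E) (hV : G.vertexSet = Set.univ) (hE : G.edgeSet = Set.univ)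
    (hloop : G.Loopless)
    -- terminals, no two of which are adjacent
    {s k : ℕ} (T : Mader.TerminalFamily V s k)
    (hT : ∀ e i j, ¬ G.IsLink e (T.term i) (T.term j))
    -- pairwise linearly independent vectors, an orientation of `G*`, and a positive edge length
    (b : Fin s → Fin 2 → K) (hb : ∀ a a', a ≠ a' → LinearIndependent K ![b a, b a'])
    (o : Mader.Orientation (Mader.starGraph G T))
    (l : E → ℝ) (hl : ∀ e, 0 < l e) :
    -- `σ_P` is well defined, and `c_P` is nonzero
    (∀ P : Finset E, Mader.IsDisjointPath G T P →
      (∃! σ, Mader.ConnectsVia G T P σ) ∧ Mader.pathConst G T b P ≠ 0) ∧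
    -- the determinant formula
    (∀ (P : Finset E) (B : Finset (E ⊕ T.Free)), Mader.IsDisjointPath G T P →
      MatroidParity.IsParityBase (Mader.yamaguchiMatrix G T o b) B → P ⊆ B.toLeft →
      MatroidParity.detLines (Mader.yamaguchiMatrix G T o b) B =
        (-1) ^ k * Mader.pathConst G T b P * (Mader.pathSign G T P : K)) ∧
    -- three parts: `c_P` is constant, and the LGV position yields a Pfaffian parity
    (s = 3 →
      (∀ P Q : Finset E, Mader.IsDisjointPath G T P → Mader.IsDisjointPath G T Q →
        Mader.pathConst G T b P = Mader.pathConst G T b Q) ∧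
      (Mader.InLGVPosition G T →
        MatroidParity.IsPfaffian (Mader.yamaguchiMatrix G T o b) ∧
        ∀ P : Finset E, Mader.IsDisjointPath G T P →
          MatroidParity.IsPfaffianWithConstant (Mader.yamaguchiMatrix G T o b)
            ((-1) ^ k * Mader.pathConst G T b P * (Mader.pathSign G T P : K)))) ∧
    -- the minimum length equals the minimum weight (and one exists if and only if the other does)
    (∀ x : ℝ,
      IsLeast ((fun P : Finset E => ∑ e ∈ P, l e) '' {P | Mader.IsDisjointPath G T P}) x ↔
      IsLeast ((fun B : Finset (E ⊕ T.Free) => ∑ e ∈ B, Mader.starWeight T l e) ''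
        {B | MatroidParity.IsParityBase (Mader.yamaguchiMatrix G T o b) B}) x) ∧
    -- `B ↦ B ∩ E` is a one-to-one correspondence of the optimal solutions
    Set.BijOn (fun B : Finset (E ⊕ T.Free) => B.toLeft)
      {B | MatroidParity.IsMinWeightParityBase (Mader.yamaguchiMatrix G T o b)
        (Mader.starWeight T l) B}
      {P | Mader.IsShortestDisjointPath G T l P} := by
  classical
  have hPB := fun (P : Finset E) (hP : Mader.IsDisjointPath G T P) =>
    Mader.isParityBase_iff_toRight_eq (o := o) hE hloop hT hb hP
  have hext : ∀ P, Mader.IsDisjointPath G T P → ∃ B : Finset (E ⊕ T.Free),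
      MatroidParity.IsParityBase (Mader.yamaguchiMatrix G T o b) B ∧ B.toLeft = P := by
    intro P hP
    obtain ⟨S, hS⟩ := hPB P hP
    have hl : (P.disjSum S).toLeft = P := Finset.toLeft_disjSum
    exact ⟨P.disjSum S, (hS _ hl).2 Finset.toRight_disjSum, hl⟩
  have hbase := fun (B : Finset (E ⊕ T.Free))
      (hB : MatroidParity.IsParityBase (Mader.yamaguchiMatrix G T o b) B) =>
    Mader.exists_isDisjointPath_of_isParityBase hV hE hloop hT hB
  have hmono : ∀ P Q : Finset E, P ⊆ Q → ∑ e ∈ P, l e ≤ ∑ e ∈ Q, l e := fun P Q h =>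
    Finset.sum_le_sum_of_subset_of_nonneg h fun e _ _ => (hl e).le
  have hdet : ∀ (P : Finset E) (B : Finset (E ⊕ T.Free)), Mader.IsDisjointPath G T P →
      MatroidParity.IsParityBase (Mader.yamaguchiMatrix G T o b) B → P ⊆ B.toLeft →
      MatroidParity.detLines (Mader.yamaguchiMatrix G T o b) B =
        (-1) ^ k * Mader.pathConst G T b P * (Mader.pathSign G T P : K) :=
    fun P B hP hB hPB =>
      Mader.detLines_eq_of_connectsVia hE hloop hT (Mader.connectsVia_pathPerm hP) hB hPB
  have hmin_path : ∀ B, MatroidParity.IsMinWeightParityBase (Mader.yamaguchiMatrix G T o b)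
      (Mader.starWeight T l) B → Mader.IsDisjointPath G T B.toLeft := by
    rintro B ⟨hB, hmin⟩
    simp only [Mader.sum_starWeight] at hmin
    obtain ⟨P, hP, hPB⟩ := hbase B hB
    -- If `P` were a proper subset, the parity base extending `P` by new edges would be strictly
    -- lighter, because lengths are positive.
    suffices hEq : P = B.toLeft from hEq ▸ hP
    by_contra hne
    obtain ⟨B', hB', rfl⟩ := hext P hP
    obtain ⟨e, he, he'⟩ := Finset.exists_of_ssubset (hPB.ssubset_of_ne hne)
    exact absurd (hmin B' hB') (not_le.2
      (Finset.sum_lt_sum_of_subset hPB he he' (hl e) fun e _ _ => (hl e).le))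
  refine ⟨fun P hP => ⟨?_, Mader.pathConst_ne_zero hb hP⟩, hdet, ?_, ?_, ?_, ?_, ?_⟩
  · exact ⟨_, Mader.connectsVia_pathPerm hP,
      fun τ hτ => hτ.unique (Mader.connectsVia_pathPerm hP)⟩
  · rintro rfl
    refine ⟨fun P Q hP hQ => Mader.pathConst_eq_of_three b hP hQ, fun hLGV => ?_⟩
    have hpf : ∀ P : Finset E, Mader.IsDisjointPath G T P →
        MatroidParity.IsPfaffianWithConstant (Mader.yamaguchiMatrix G T o b)
          ((-1) ^ k * Mader.pathConst G T b P * (Mader.pathSign G T P : K)) := by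
      intro P hP
      refine ⟨?_, fun B hB => ?_⟩
      · obtain ⟨B, hB, hBP⟩ := hext P hP
        rw [← hdet P B hP hB hBP.ge]
        exact hB.2
      · obtain ⟨Q, hQ, hQB⟩ := hbase B hB
        rw [hdet Q B hQ hB hQB, Mader.pathConst_eq_of_three b hQ hP, hLGV Q P hQ hP]
    refine ⟨?_, hpf⟩
    by_cases h : ∃ P, Mader.IsDisjointPath G T P
    · obtain ⟨P, hP⟩ := h
      exact ⟨_, hpf P hP⟩
    -- Without disjoint paths there are no parity bases, and any nonzero constant serves.
    · refine ⟨1, one_ne_zero, fun B hB => ?_⟩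
      obtain ⟨Q, hQ, -⟩ := hbase B hB
      exact absurd ⟨Q, hQ⟩ h
  · intro x
    simp only [Mader.sum_starWeight]
    constructor
    · rintro ⟨⟨P, hP, rfl⟩, hx⟩
      obtain ⟨B, hB, rfl⟩ := hext P hP
      refine ⟨⟨B, hB, rfl⟩, ?_⟩
      rintro _ ⟨B', hB', rfl⟩
      obtain ⟨Q, hQ, hQB⟩ := hbase B' hB'
      exact (hx ⟨Q, hQ, rfl⟩).trans (hmono _ _ hQB)
    · rintro ⟨⟨B, hB, rfl⟩, hx⟩
      obtain ⟨P, hP, hPB⟩ := hbase B hB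
      obtain ⟨B', hB', hBP⟩ := hext P hP
      refine ⟨⟨P, hP, le_antisymm (hmono _ _ hPB) ?_⟩, ?_⟩
      · have := hx ⟨B', hB', rfl⟩
        simpa [hBP] using this
      · rintro _ ⟨Q, hQ, rfl⟩
        obtain ⟨B'', hB'', rfl⟩ := hext Q hQ
        exact hx ⟨B'', hB'', rfl⟩
  · intro B hB
    refine ⟨hmin_path B hB, fun Q hQ => ?_⟩
    obtain ⟨B', hB', rfl⟩ := hext Q hQ
    simpa only [Mader.sum_starWeight] using hB.2 B' hB'
  · intro B hB B' hB' (hBB : B.toLeft = B'.toLeft)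
    -- The trace on `E` is a disjoint path, which determines the new edges of any parity base with
    -- that trace.
    obtain ⟨S, hS⟩ := hPB _ (hmin_path B hB)
    rw [← Finset.toLeft_disjSum_toRight (u := B), ← Finset.toLeft_disjSum_toRight (u := B'),
      (hS B rfl).1 hB.1, (hS B' hBB.symm).1 hB'.1, hBB]
  · rintro P ⟨hP, hmin⟩
    obtain ⟨B, hB, hBP⟩ := hext P hP
    refine ⟨B, ⟨hB, fun B' hB' => ?_⟩, hBP⟩
    obtain ⟨Q, hQ, hQB⟩ := hbase B' hB'
    simp only [Mader.sum_starWeight, hBP]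
    exact (hmin Q hQ).trans (hmono _ _ hQB)
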